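/- Let $N\ge 2$ and $K\ge 2$ be integers and let $\mathcal X$ be a finite alphabet with $|\mathcal X|\ge 2$. All entropies and mutual informations are discrete and in base $|\mathcal X|$. A private information retrieval (PIR) scheme of message length $L\ge 1$ consists of the following. The messages $W_1,\dots,W_K$ are independent and uniform on $\mathcal X^L$, and each of $N$ databases stores all of them. The user holds a discrete random key $\mathbf F$, the databases share discrete common randomness $S$ unknown to the user, and $W_{1:K},\mathbf F,S$ are independent. To retrieve $W_k$, the user sends to database $n$ a query $Q_n^{[k]}$, which is a function of $\mathbf F$. Database $n$ returns $A_n^{[k]}=\varphi_n(Q_n^{[k]},W_{1:K},S)\in\mathcal Y^{\ell_n}$, where $\mathcal Y$ is a finite alphabet chosen by the scheme and the length $\ell_n$ depends only on the query. It is required that $W_k$ is determined almost surely by $A_{1:N}^{[k]}$ and $\mathbf F$, for each $k$, and that for each $n$ the law of $Q_n^{[k]}$ does not depend on $k$. The download cost is $D=\log_{|\mathcal X|}|\mathcal Y|\sum_{n=1}^N\mathbb E(\ell_n)$ (the same for every $k$), and the amount of common randomness is $\rho=H(S)/L$. The scheme satisfies the total leakage constraint $s$ if $\frac1L I\big((W_j)_{j\ne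 k};\,Q_{1:N}^{[k]},A_{1:N}^{[k]},\mathbf F\big)\le s$ for every $k$. For real $s\ge 0$ and $\rho\ge 0$ let $D_{\min}(L)=D_{\min}(L;s,\rho)$ be the infimum of $D$ over all schemes of message length $L$ with total leakage constraint $s$ and amount of common randomness $\rho$ ($D_{\min}(L)=\infty$ if there is none). Put $$\rho_{\min}^{\mathrm s}=\frac1{N-1}-\frac{N^{K-1}}{N^{K-1}-1}\,s,\qquad s_t=\frac1{N-1}\Big(1-\frac1{N^{K-1}}\Big),$$ $$d(s)=\begin{cases}\dfrac N{N-1}-\dfrac{s}{N^{K-1}-1}, & 0\le s\le s_t,\\[2mm] 1+\dfrac1N+\cdots+\dfrac1{N^{K-1}}, & s>s_t.\end{cases}$$ **Theorem.** (1) If $\rho\ge\rho_{\min}^{\mathrm s}$, then the minimum download cost per message symbol is $d(s)$. That is, $D_{\min}(L)\ge L\,d(s)$ for every $L\ge 1$, and $\inf_{L\ge1}D_{\min}(L)/L=d(s)$. Moreover, for every positive multiple $L$ of $N-1$ such that some integer $m\ge0$ satisfies $\rho_{\min}^{\mathrm s}L\le m\le\rho L$ (in particular for $L=N-1$ if $\rho\ge\frac1{N-1}$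 or $s\ge s_t$), the minimum is attained by a scheme of message length $L$: $D_{\min}(L)=L\,d(s)$. (2) If $\rho<\rho_{\min}^{\mathrm s}$, then for no $L\ge1$ is there a scheme with total leakage constraint $s$ and amount of common randomness $\rho$, that is, $D_{\min}(L)=\infty$. -/

import Mathlib

open scoped ENNReal

namespace PIR

noncomputable section

/-- Shannon entropy, in base `b` units, of a discrete law. Every summand is nonnegative; the value
`∞` is possible when the support is infinite. -/
def entropy {α : Type*} (b : ℝ) (p : PMF α) : ℝ≥0∞ :=
  ∑' a, ENNReal.ofReal (Real.negMulLog (p a).toReal / Real.log b)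

/-- Conditional entropy `H(U | Z) = ∑ P(u, z) log (P(z) / P(u, z))`, in base `b` units, where `r` is
the joint law of the pair `(U, Z)`. Every summand is nonnegative because `P(u, z) ≤ P(z)`. -/
def condEntropy {α β : Type*} (b : ℝ) (r : PMF (α × β)) : ℝ≥0∞ :=
  ∑' x : α × β, ENNReal.ofReal
    ((r x).toReal * Real.logb b ((r.map Prod.snd x.2).toReal / (r x).toReal))

/-- Mutual information `I(U; Z) = H(U) - H(U | Z)`, in base `b` units, where `r` is the joint law
of `(U, Z)`. It is used only for `U` with finitely many values, so that both terms are finite. -/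
def mutualInfo {α β : Type*} (b : ℝ) (r : PMF (α × β)) : ℝ≥0∞ :=
  entropy b (r.map Prod.fst) - condEntropy b r

/-- `K` messages, each a string of `L` symbols of the alphabet `X`. -/
abbrev Messages (K L : ℕ) (X : Type*) : Type _ := Fin K → Fin L → X

/-- A private information retrieval scheme for `K` messages of length `L` over the alphabet `X`,
replicated on `N` databases. The random keys are discrete. -/
structure Scheme (N K L : ℕ) (X : Type*) where
  /-- alphabet of the user's random key `F` -/
  Key : Type
  /-- law of the user's random key `F` -/
  keyLaw : PMF Key
  /-- alphabet of the common randomness `S`, shared by the databases and unknown to the user -/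
  Com : Type
  /-- law of the common randomness `S` -/
  comLaw : PMF Com
  /-- alphabet of the queries to the database `n` -/
  Query : Fin N → Type
  /-- the query `Q_n^{[k]}` is a function of the user's key -/
  query : ∀ n : Fin N, Fin K → Key → Query n
  /-- finite alphabet `Y` of the answer symbols -/
  Sym : Type
  [symFintype : Fintype Sym]
  /-- number `ℓ_n` of answer symbols; it depends on the query only -/
  len : ∀ n : Fin N, Query n → ℕ
  /-- answer of the database `n`, a function of the query, all the messages and `S` -/
  answer : ∀ n : Fin N, Query n → Messages K L X → Com → List Sym
  length_answer : ∀ n q w c, (answer n q w c).length = len n q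
  /-- the user's decoder -/
  decode : Fin K → Key → (Fin N → List Sym) → (Fin L → X)
  /-- perfect retrieval of the desired message -/
  decode_eq : ∀ k, ∀ f ∈ keyLaw.support, ∀ w, ∀ c ∈ comLaw.support,
    decode k f (fun n => answer n (query n k f) w c) = w k
  /-- privacy: the law of each single query does not depend on the desired index -/
  privacy : ∀ n k k', keyLaw.map (query n k) = keyLaw.map (query n k')

attribute [instance] Scheme.symFintype

namespace Scheme

variable {N K L : ℕ} {X : Type*} [Fintype X] [Nontrivial X]

/-- Joint law of `(W_1, …, W_K)`, `F` and `S`: they are independent, and the message symbols are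
independent and uniform on `X`. -/
def jointLaw (C : Scheme N K L X) : PMF (Messages K L X × C.Key × C.Com) :=
  (PMF.uniformOfFintype (Messages K L X)).bind fun w =>
    C.keyLaw.bind fun f => C.comLaw.map fun c => (w, f, c)

/-- What the user knows at the end when `k` is the desired index: his key, all the queries, and all
the answers. -/
def view (C : Scheme N K L X) (k : Fin K) (x : Messages K L X × C.Key × C.Com) :
    C.Key × (∀ n, C.Query n) × (Fin N → List C.Sym) :=
  (x.2.1, fun n => C.query n k x.2.1,
    fun n => C.answer n (C.query n k x.2.1) x.1 x.2.2)

/-- Total leakage: the mutual information, in base `|X|` units, of all the messages other than the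
`k`-th one with the view of the user who retrieves message `k`. -/
def totalLeakage (C : Scheme N K L X) (k : Fin K) : ℝ≥0∞ :=
  mutualInfo (Fintype.card X) (C.jointLaw.map fun x =>
    ((fun j : {j : Fin K // j ≠ k} => x.1 j), C.view k x))

/-- Entropy `H(S)` of the common randomness, in base `|X|` units. -/
def commonEntropy (C : Scheme N K L X) : ℝ≥0∞ :=
  entropy (Fintype.card X) C.comLaw

/-- Download cost `log_{|X|} |Y| * ∑ n, E[ℓ_n]` when `k` is the desired index. -/
def downloadCost (C : Scheme N K L X) (k : Fin K) : ℝ≥0∞ :=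
  ENNReal.ofReal (Real.logb (Fintype.card X) (Fintype.card C.Sym)) *
    ∑ n, ∑' f, C.keyLaw f * (C.len n (C.query n k f) : ℝ≥0∞)

end Scheme

/-- The download costs (the same for every desired index, by privacy) of the schemes with message
length `L` whose normalized total leakage is at most `s` for every desired index, and whose
normalized amount of common randomness `H(S) / L` is `ρ`. -/
def costs (N K L : ℕ) (X : Type*) [Fintype X] [Nontrivial X] (s ρ : ℝ) : Set ℝ≥0∞ :=
  {D | ∃ C : Scheme N K L X,
    (∀ k, C.totalLeakage k ≤ ENNReal.ofReal (s * L)) ∧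
    C.commonEntropy = ENNReal.ofReal (ρ * L) ∧
    ∀ k, C.downloadCost k = D}

/-- Minimum download cost for the message length `L`; it is `∞` if there is no scheme. -/
def minCost (N K L : ℕ) (X : Type*) [Fintype X] [Nontrivial X] (s ρ : ℝ) : ℝ≥0∞ :=
  sInf (costs N K L X s ρ)

/-- Minimum download cost per message symbol, over all message lengths. -/
def minRate (N K : ℕ) (X : Type*) [Fintype X] [Nontrivial X] (s ρ : ℝ) : ℝ≥0∞ :=
  ⨅ (L : ℕ) (_ : 1 ≤ L), minCost N K L X s ρ / L

/-- The smallest normalized amount of common randomness. -/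
def rhoMin (N K : ℕ) (s : ℝ) : ℝ :=
  1 / ((N : ℝ) - 1) - (N : ℝ) ^ (K - 1) / ((N : ℝ) ^ (K - 1) - 1) * s

/-- The leakage threshold. -/
def threshold (N K : ℕ) : ℝ :=
  1 / ((N : ℝ) - 1) * (1 - 1 / (N : ℝ) ^ (K - 1))

/-- The claimed minimum download cost per message symbol. -/
def optRate (N K : ℕ) (s : ℝ) : ℝ :=
  if s ≤ threshold N K then
    (N : ℝ) / ((N : ℝ) - 1) - 1 / ((N : ℝ) ^ (K - 1) - 1) * s
  else
    ∑ i ∈ Finset.range K, 1 / (N : ℝ) ^ i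

end

end PIR

/-!
Write `x_k = H(A | F, W_k)` and `y_k = H(A | F, W_{1:K})` for the entropies of all the answers when
the message `k` is desired. Since `A` and `F` determine `W_k`, the total leakage is `x_k - y_k`
(`Scheme.totalLeakage_le_iff`) and the download cost is at least `H(A | F) = L + x_k`. Moreover
`y_k ≤ H(S)`, because only the common randomness is left once the messages and the key are given.

Privacy makes the entropy of a single answer, given any set `T` of messages, independent of the
desired index, so `H(A^{[k']} | F, W_T) ≤ N H(A^{[k]} | F, W_T)`. Choosing `k' ∉ T` and splitting off
`W_{k'}`, one adds `k'` to `T`. After `K - 1` steps (`Scheme.le_answersEntropy`), for an index `k` with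
the smallest `y_k`,
`N^(K-1) x_k ≥ L (1 + N + ⋯ + N^(K-2)) + y_k`.
Together with `x_k - y_k ≤ s L` and `y_k ≤ ρ L`, this is a linear system from which the bound
on the cost and the necessity of `rhoMin ≤ ρ` both follow (`Scheme.optRate_le_and_rhoMin_le`).
All entropies are means over the key and take values in `[0, ∞]`, so that infinite key spaces, costs
and randomness need no separate treatment.

For attainability, each message is cut into `N - 1` rows of `t` letters. In the
Tian–Sun–Chen scheme every database returns a sum of rows, one of each message, and exactly one
database sees no row of `W_k`; it returns the interference alone. Adding to every answer a mask `σ`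
from the common randomness hides the interference, a uniform vector of `t` letters, up to
`t - H(σ)`, whatever the law of `σ`. The price is that the database that is asked for no row at all
has to send the mask. If the mask occupies `m` columns and is used with probability `p`, then the
cost is `N t - (t - p m) / N^(K-1)` and the leakage is at most `(1 - 1 / N^(K-1)) (t - p H(σ))`
(`mem_costs`). With `H(σ) = m` and `p m = max (rhoMin * L) 0` this is optimal (`optimal_mem_costs`).
If no whole number `m` fits, a non-uniform mask of entropy exactly `max (rhoMin * L) 0` is used; it
costs at most one letter more, which is negligible for long messages (`minCost_le`).
-/

namespace PIR

noncomputable section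

/-! ### Means over discrete laws, and product laws -/

section Sums

variable {α β : Type*}

theorem tsum_pure_mul (a : α) (φ : α → ℝ≥0∞) : ∑' x, (PMF.pure a) x * φ x = φ a := by
  rw [tsum_eq_single a]
  · simp
  · intro x hx; simp [PMF.pure_apply, hx]

theorem tsum_bind_mul (p : PMF α) (f : α → PMF β) (φ : β → ℝ≥0∞) :
    ∑' y, (p.bind f) y * φ y = ∑' x, p x * ∑' y, f x y * φ y := by
  simp_rw [PMF.bind_apply, ← ENNReal.tsum_mul_right, ← ENNReal.tsum_mul_left]
  rw [ENNReal.tsum_comm]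
  simp_rw [mul_assoc]

theorem tsum_map_mul (p : PMF α) (f : α → β) (φ : β → ℝ≥0∞) :
    ∑' y, (p.map f) y * φ y = ∑' x, p x * φ (f x) := by
  rw [← PMF.bind_pure_comp, tsum_bind_mul]
  simp_rw [Function.comp_apply, tsum_pure_mul]

theorem tsum_const_mul (p : PMF α) (c : ℝ≥0∞) : ∑' x, p x * c = c := by
  rw [ENNReal.tsum_mul_right, p.tsum_coe, one_mul]

theorem tsum_mul_le_tsum_mul (p : PMF α) {φ ψ : α → ℝ≥0∞} (h : ∀ a ∈ p.support, φ a ≤ ψ a) :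
    ∑' x, p x * φ x ≤ ∑' x, p x * ψ x := by
  refine ENNReal.tsum_le_tsum fun a => ?_
  by_cases ha : p a = 0
  · simp [ha]
  · gcongr; exact h a ((p.mem_support_iff a).2 ha)

theorem tsum_mul_congr (p : PMF α) {φ ψ : α → ℝ≥0∞} (h : ∀ a ∈ p.support, φ a = ψ a) :
    ∑' x, p x * φ x = ∑' x, p x * ψ x :=
  le_antisymm (tsum_mul_le_tsum_mul p fun a ha => (h a ha).le)
    (tsum_mul_le_tsum_mul p fun a ha => (h a ha).ge)

theorem le_map_apply (p : PMF α) (f : α → β) (a : α) : p a ≤ (p.map f) (f a) := by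
  classical
  rw [PMF.map_apply]
  refine le_trans ?_ (ENNReal.le_tsum a)
  simp

theorem map_apply_of_injOn (p : PMF α) (f : α → β) (hf : Set.InjOn f p.support) {a : α}
    (ha : a ∈ p.support) : (p.map f) (f a) = p a := by
  classical
  rw [PMF.map_apply, tsum_eq_single a]
  · simp
  · intro x hx
    by_cases h : f a = f x
    · simp only [h, if_true]
      by_contra h0
      exact hx (hf ((p.mem_support_iff x).2 h0) ha h.symm)
    · simp [h]

theorem map_congr_support (p : PMF α) {f g : α → β} (h : ∀ a ∈ p.support, f a = g a) :
    p.map f = p.map g := by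
  classical
  ext y
  rw [PMF.map_apply, PMF.map_apply]
  refine tsum_congr fun a => ?_
  by_cases ha : p a = 0
  · simp [ha]
  · rw [h a ((p.mem_support_iff a).2 ha)]

/-- The law of a pair of independent random variables with laws `p` and `q`. -/
def prodLaw (p : PMF α) (q : PMF β) : PMF (α × β) :=
  p.bind fun a => q.map (Prod.mk a)

theorem prodLaw_apply (p : PMF α) (q : PMF β) (x : α × β) : prodLaw p q x = p x.1 * q x.2 := by
  classical
  obtain ⟨a, b⟩ := x
  rw [prodLaw, PMF.bind_apply, tsum_eq_single a]
  · rw [PMF.map_apply, tsum_eq_single b]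
    · simp
    · intro y hy; simp [hy.symm]
  · intro y hy
    rw [PMF.map_apply]
    simp [hy.symm]

theorem tsum_prodLaw_mul (p : PMF α) (q : PMF β) (φ : α × β → ℝ≥0∞) :
    ∑' x, prodLaw p q x * φ x = ∑' a, p a * ∑' b, q b * φ (a, b) := by
  rw [prodLaw, tsum_bind_mul]
  simp_rw [tsum_map_mul]

theorem map_prodLaw {γ : Type*} (p : PMF α) (q : PMF β) (f : α × β → γ) :
    (prodLaw p q).map f = p.bind fun a => q.map fun b => f (a, b) := by
  rw [prodLaw, PMF.map_bind]
  simp_rw [PMF.map_comp]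
  rfl

theorem prodLaw_map_fst (p : PMF α) (q : PMF β) : (prodLaw p q).map Prod.fst = p := by
  rw [map_prodLaw]
  exact (congrArg p.bind (funext fun a => PMF.map_const q a)).trans p.bind_pure

theorem prodLaw_map_snd (p : PMF α) (q : PMF β) : (prodLaw p q).map Prod.snd = q := by
  rw [map_prodLaw]
  exact (congrArg p.bind (funext fun _ => PMF.map_id q)).trans (p.bind_const q)

theorem prodLaw_uniform [Fintype α] [Nonempty α] [Fintype β] [Nonempty β] :
    prodLaw (PMF.uniformOfFintype α) (PMF.uniformOfFintype β) = PMF.uniformOfFintype (α × β) := by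
  ext x
  rw [prodLaw_apply]
  simp only [PMF.uniformOfFintype_apply, Fintype.card_prod, Nat.cast_mul]
  rw [ENNReal.mul_inv] <;> simp

theorem uniform_map_equiv [Fintype α] [Nonempty α] [Fintype β] [Nonempty β] (e : α ≃ β) :
    (PMF.uniformOfFintype α).map e = PMF.uniformOfFintype β := by
  ext y
  obtain ⟨x, rfl⟩ := e.surjective y
  rw [map_apply_of_injOn _ _ e.injective.injOn (by simp)]
  simp [Fintype.card_congr e]

end Sums

/-! ### Discrete entropy -/

section Entropy

variable {α β γ : Type*} {b : ℝ}

/-- The information content `-log_b x` of an event of probability `x`. -/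
def info (b : ℝ) (x : ℝ≥0∞) : ℝ≥0∞ := ENNReal.ofReal (-Real.logb b x.toReal)

/-- Entropy is the mean information content. -/
theorem entropy_eq_tsum (p : PMF α) : entropy b p = ∑' a, p a * info b (p a) := by
  refine tsum_congr fun a => ?_
  rw [info, ← ENNReal.ofReal_toReal (p.apply_ne_top a), ← ENNReal.ofReal_mul ENNReal.toReal_nonneg,
    ENNReal.toReal_ofReal ENNReal.toReal_nonneg, Real.negMulLog, Real.logb]
  congr 1; ring

theorem entropy_map (p : PMF α) (f : α → β) :
    entropy b (p.map f) = ∑' a, p a * info b ((p.map f) (f a)) := by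
  rw [entropy_eq_tsum, tsum_map_mul p f fun y => info b ((p.map f) y)]

theorem info_anti (hb : 1 < b) {x y : ℝ≥0∞} (hx : x ≠ 0) (hxy : x ≤ y) (hy : y ≠ ∞) :
    info b y ≤ info b x := by
  refine ENNReal.ofReal_le_ofReal (neg_le_neg ?_)
  exact Real.logb_le_logb_of_le hb (ENNReal.toReal_pos hx (ne_top_of_le_ne_top hy hxy))
    (ENNReal.toReal_mono hy hxy)

theorem info_mul (hb : 1 < b) {x y : ℝ≥0∞} (hx0 : x ≠ 0) (hx1 : x ≤ 1) (hy0 : y ≠ 0)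
    (hy1 : y ≤ 1) : info b (x * y) = info b x + info b y := by
  have hxt := ne_top_of_le_ne_top ENNReal.one_ne_top hx1
  have hyt := ne_top_of_le_ne_top ENNReal.one_ne_top hy1
  have key : ∀ z : ℝ≥0∞, z ≤ 1 → 0 ≤ -Real.logb b z.toReal := fun z hz =>
    neg_nonneg.2 (Real.logb_nonpos hb ENNReal.toReal_nonneg
      (by simpa using ENNReal.toReal_mono ENNReal.one_ne_top hz))
  rw [info, info, info, ← ENNReal.ofReal_add (key x hx1) (key y hy1), ENNReal.toReal_mul,
    Real.logb_mul (ENNReal.toReal_pos hx0 hxt).ne' (ENNReal.toReal_pos hy0 hyt).ne']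
  congr 1; ring

theorem info_inv_natCast (n : ℕ) : info b ((n : ℝ≥0∞)⁻¹) = ENNReal.ofReal (Real.logb b n) := by
  simp [info, ENNReal.toReal_inv, Real.logb_inv]

theorem info_one : info b 1 = 0 := by simp [info]

/-- A function of a random variable has at most its entropy. -/
theorem entropy_map_le (hb : 1 < b) (p : PMF α) (f : α → β) :
    entropy b (p.map f) ≤ entropy b p := by
  rw [entropy_map, entropy_eq_tsum]
  refine tsum_mul_le_tsum_mul p fun a ha => ?_
  exact info_anti hb ((p.mem_support_iff a).1 ha) (le_map_apply p f a) ((p.map f).apply_ne_top _)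

theorem entropy_map_of_injOn (p : PMF α) (f : α → β) (hf : Set.InjOn f p.support) :
    entropy b (p.map f) = entropy b p := by
  rw [entropy_map, entropy_eq_tsum]
  exact tsum_mul_congr p fun a ha => by rw [map_apply_of_injOn p f hf ha]

theorem entropy_pure (a : α) : entropy b (PMF.pure a) = 0 := by
  rw [entropy_eq_tsum, tsum_pure_mul a fun x => info b (PMF.pure a x)]
  simp [info_one]

theorem entropy_uniform [Fintype α] [Nonempty α] :
    entropy b (PMF.uniformOfFintype α) = ENNReal.ofReal (Real.logb b (Fintype.card α)) := by
  rw [entropy_eq_tsum]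
  simp_rw [PMF.uniformOfFintype_apply, info_inv_natCast]
  simpa only [PMF.uniformOfFintype_apply] using
    tsum_const_mul (PMF.uniformOfFintype α) (ENNReal.ofReal (Real.logb b (Fintype.card α)))

theorem entropy_prodLaw (hb : 1 < b) (p : PMF α) (q : PMF β) :
    entropy b (prodLaw p q) = entropy b p + entropy b q := by
  rw [entropy_eq_tsum, tsum_prodLaw_mul p q fun x => info b (prodLaw p q x)]
  have : ∀ a ∈ p.support, ∑' y, q y * info b (prodLaw p q (a, y))
      = info b (p a) + entropy b q := by
    intro a ha
    rw [entropy_eq_tsum, ← tsum_const_mul q (info b (p a)), ← ENNReal.tsum_add]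
    simp_rw [← mul_add]
    refine tsum_mul_congr q fun y hy => ?_
    rw [prodLaw_apply, info_mul hb ((p.mem_support_iff a).1 ha) (p.coe_le_one a)
      ((q.mem_support_iff y).1 hy) (q.coe_le_one y)]
  rw [tsum_mul_congr p this]
  simp_rw [mul_add]
  rw [ENNReal.tsum_add, tsum_const_mul, ← entropy_eq_tsum]

/-- Gibbs' inequality: the entropy of `p` is at most its cross-entropy with a subprobability `q`. -/
theorem entropy_le_tsum_info (hb : 1 < b) (p : PMF α) (q : α → ℝ≥0∞) (hq : ∑' a, q a ≤ 1)
    (hpq : ∀ a ∈ p.support, q a ≠ 0) : entropy b p ≤ ∑' a, p a * info b (q a) := by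
  have hlb : 0 < Real.log b := Real.log_pos hb
  have hq1 : ∀ a, q a ≤ 1 := fun a => (ENNReal.le_tsum a).trans hq
  set c : ℝ≥0∞ := ENNReal.ofReal (1 / Real.log b) with hc
  -- `log u ≤ u - 1` at `u = q a / p a`, written without subtraction
  have key : ∀ a, p a * info b (p a) + p a * c ≤ p a * info b (q a) + q a * c := by
    intro a
    by_cases ha : p a = 0
    · simp [ha]
    have hqa := hpq a ((p.mem_support_iff a).2 ha)
    have hqt := ne_top_of_le_ne_top ENNReal.one_ne_top (hq1 a)
    have hx : 0 < (p a).toReal := ENNReal.toReal_pos ha (p.apply_ne_top a)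
    have hy : 0 < (q a).toReal := ENNReal.toReal_pos hqa hqt
    have hx1 : (p a).toReal ≤ 1 := by
      simpa using ENNReal.toReal_mono ENNReal.one_ne_top (p.coe_le_one a)
    have hy1 : (q a).toReal ≤ 1 := by
      simpa using ENNReal.toReal_mono ENNReal.one_ne_top (hq1 a)
    have h1 := neg_nonneg.2 (Real.logb_nonpos hb hx.le hx1)
    have h2 := neg_nonneg.2 (Real.logb_nonpos hb hy.le hy1)
    rw [← ENNReal.ofReal_toReal (p.apply_ne_top a), ← ENNReal.ofReal_toReal hqt, info, info, hc]
    simp only [ENNReal.toReal_ofReal ENNReal.toReal_nonneg]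
    have h3 : 0 ≤ 1 / Real.log b := by positivity
    rw [← ENNReal.ofReal_mul hx.le, ← ENNReal.ofReal_mul hx.le, ← ENNReal.ofReal_mul hx.le,
      ← ENNReal.ofReal_mul hy.le, ← ENNReal.ofReal_add (by positivity) (by positivity),
      ← ENNReal.ofReal_add (by positivity) (by positivity)]
    refine ENNReal.ofReal_le_ofReal ?_
    have h4 : Real.log ((q a).toReal / (p a).toReal) ≤ (q a).toReal / (p a).toReal - 1 :=
      Real.log_le_sub_one_of_pos (by positivity)
    rw [Real.log_div hy.ne' hx.ne'] at h4
    have h5 : (p a).toReal * (Real.log (q a).toReal - Real.log (p a).toReal)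
        ≤ (q a).toReal - (p a).toReal := by
      calc _ ≤ (p a).toReal * ((q a).toReal / (p a).toReal - 1) := by gcongr
        _ = _ := by field_simp
    have h6 := div_le_div_of_nonneg_right h5 hlb.le
    simp only [Real.logb]
    have e1 : (p a).toReal * (Real.log (q a).toReal - Real.log (p a).toReal) / Real.log b
      = (p a).toReal * (Real.log (q a).toReal / Real.log b)
        - (p a).toReal * (Real.log (p a).toReal / Real.log b) := by ring
    have e2 : ((q a).toReal - (p a).toReal) / Real.log b
      = (q a).toReal * (1 / Real.log b) - (p a).toReal * (1 / Real.log b) := by ring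
    rw [e1, e2] at h6
    linarith
  have hsum := ENNReal.tsum_le_tsum key
  rw [ENNReal.tsum_add, ENNReal.tsum_add, ← entropy_eq_tsum, tsum_const_mul,
    ENNReal.tsum_mul_right] at hsum
  refine (ENNReal.add_le_add_iff_right (a := c) ENNReal.ofReal_ne_top).1 (hsum.trans ?_)
  gcongr
  exact mul_le_of_le_one_left' hq

theorem entropy_le_of_support (hb : 1 < b) (p : PMF α) (s : Finset α)
    (hs : ∀ a ∈ p.support, a ∈ s) : entropy b p ≤ ENNReal.ofReal (Real.logb b s.card) := by
  classical
  have h := entropy_le_tsum_info hb p (fun a => if a ∈ s then (s.card : ℝ≥0∞)⁻¹ else 0) ?_ ?_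
  · refine h.trans_eq ?_
    rw [← tsum_const_mul p (ENNReal.ofReal _), ← info_inv_natCast]
    exact tsum_mul_congr p fun a ha => by simp [hs a ha]
  · rw [tsum_eq_sum (s := s) (by intro a ha; simp [ha])]
    rw [Finset.sum_congr rfl fun a ha => if_pos ha]
    simp only [Finset.sum_const, nsmul_eq_mul]
    exact ENNReal.mul_inv_le_one _
  · intro a ha
    simp [hs a ha]

theorem entropy_le_log_card (hb : 1 < b) [Fintype α] (p : PMF α) :
    entropy b p ≤ ENNReal.ofReal (Real.logb b (Fintype.card α)) :=
  entropy_le_of_support hb p Finset.univ fun _ _ => Finset.mem_univ _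

theorem entropy_pair_le (hb : 1 < b) (p : PMF α) (f : α → β) (g : α → γ) :
    entropy b (p.map fun a => (f a, g a)) ≤ entropy b (p.map f) + entropy b (p.map g) := by
  have h := entropy_le_tsum_info hb (p.map fun a => (f a, g a)) (prodLaw (p.map f) (p.map g))
    (PMF.tsum_coe _).le ?_
  · refine h.trans_eq ?_
    rw [tsum_map_mul p _ fun x => info b (prodLaw (p.map f) (p.map g) x), entropy_map,
      entropy_map, ← ENNReal.tsum_add]
    simp_rw [← mul_add]
    refine tsum_mul_congr p fun a ha => ?_
    have h1 := ((p.mem_support_iff a).1 ha).bot_lt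
    rw [prodLaw_apply, info_mul hb (h1.trans_le (le_map_apply p f a)).ne' (PMF.coe_le_one _ _)
      (h1.trans_le (le_map_apply p g a)).ne' (PMF.coe_le_one _ _)]
  · intro x hx
    rw [PMF.support_map] at hx
    obtain ⟨a, ha, rfl⟩ := hx
    have h1 := ((p.mem_support_iff a).1 ha).bot_lt
    rw [prodLaw_apply]
    exact mul_ne_zero (h1.trans_le (le_map_apply p f a)).ne' (h1.trans_le (le_map_apply p g a)).ne'

/-- Subadditivity of entropy. -/
theorem entropy_pi_le (hb : 1 < b) (p : PMF α) : ∀ {n : ℕ} (g : Fin n → α → β),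
    entropy b (p.map fun a i => g i a) ≤ ∑ i, entropy b (p.map (g i))
  | 0, g => by
    have : (fun (a : α) (i : Fin 0) => g i a) = Function.const α Fin.elim0 := by
      funext a i; exact i.elim0
    rw [this, PMF.map_const, entropy_pure]
    exact zero_le
  | n + 1, g => by
    rw [Fin.sum_univ_succ]
    have h1 : (p.map fun a i => g i a)
        = (p.map fun a => (g 0 a, fun i : Fin n => g i.succ a)).map
          fun x => (Fin.cons x.1 x.2 : Fin (n + 1) → β) := by
      rw [PMF.map_comp]
      congr 1
      funext a
      exact (Fin.cons_self_tail fun i => g i a).symm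
    rw [h1]
    refine (entropy_map_le hb _ _).trans ((entropy_pair_le hb p _ _).trans ?_)
    gcongr
    exact entropy_pi_le hb p fun i => g i.succ

/-- Chain rule for a uniform mixture whose index is a function of the outcome. -/
theorem entropy_uniform_bind (hb : 1 < b) {V : Type*} [Fintype V] [Nonempty V] (p : V → PMF α)
    (d : α → V) (hd : ∀ v, ∀ a ∈ (p v).support, d a = v) :
    entropy b ((PMF.uniformOfFintype V).bind p) = ENNReal.ofReal (Real.logb b (Fintype.card V))
      + ∑' v, PMF.uniformOfFintype V v * entropy b (p v) := by
  rw [entropy_eq_tsum, tsum_bind_mul _ _ fun a => info b ((PMF.uniformOfFintype V).bind p a),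
    ← tsum_const_mul (PMF.uniformOfFintype V) (ENNReal.ofReal _), ← ENNReal.tsum_add]
  simp_rw [← mul_add]
  refine tsum_mul_congr _ fun v _ => ?_
  rw [entropy_eq_tsum, ← info_inv_natCast, ← tsum_const_mul (p v) (info b _),
    ← ENNReal.tsum_add]
  simp_rw [← mul_add]
  refine tsum_mul_congr _ fun a ha => ?_
  rw [PMF.bind_apply, tsum_eq_single v, PMF.uniformOfFintype_apply,
    info_mul hb (by simp) (by
      rw [ENNReal.inv_le_one]; exact_mod_cast Fintype.card_pos) (((p v).mem_support_iff a).1 ha)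
      ((p v).coe_le_one a)]
  intro v' hv'
  by_contra h
  exact hv' ((hd v' a (((p v').mem_support_iff a).2 (right_ne_zero_of_mul h))).symm.trans
    (hd v a ha))

/-- Conditional entropy as a mean, with the probability moved out of `ENNReal.ofReal`. -/
theorem condEntropy_eq_tsum (r : PMF (α × β)) :
    condEntropy b r = ∑' x, r x * ENNReal.ofReal
      (Real.logb b ((r.map Prod.snd x.2).toReal / (r x).toReal)) := by
  refine tsum_congr fun y => ?_
  rw [ENNReal.ofReal_mul ENNReal.toReal_nonneg, ENNReal.ofReal_toReal (PMF.apply_ne_top _ _)]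

/-- Chain rule `H(U | Z) + H(Z) = H(U, Z)`. -/
theorem condEntropy_add_entropy (hb : 1 < b) (r : PMF (α × β)) :
    condEntropy b r + entropy b (r.map Prod.snd) = entropy b r := by
  rw [condEntropy_eq_tsum, entropy_map, entropy_eq_tsum, ← ENNReal.tsum_add]
  simp_rw [← mul_add]
  refine tsum_mul_congr r fun x hx => ?_
  have hx0 := (r.mem_support_iff x).1 hx
  have hle := le_map_apply r Prod.snd x
  have h1 := ENNReal.toReal_pos hx0 (r.apply_ne_top x)
  have h2 := ENNReal.toReal_mono (PMF.apply_ne_top _ _) hle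
  have h3 : ((r.map Prod.snd) x.2).toReal ≤ 1 := by
    simpa using ENNReal.toReal_mono ENNReal.one_ne_top ((r.map Prod.snd).coe_le_one x.2)
  rw [info, info, ← ENNReal.ofReal_add]
  · rw [Real.logb_div (h1.trans_le h2).ne' h1.ne']
    congr 1; ring
  · exact Real.logb_nonneg hb ((one_le_div h1).2 h2)
  · exact neg_nonneg.2 (Real.logb_nonpos hb ENNReal.toReal_nonneg h3)

/-- If the index `f` of a mixture is a function of the observation, then the conditional entropy
is the mean of the conditional entropies given `f`. -/
theorem condEntropy_bind {δ ι : Type*} (p : PMF ι) (r : ι → PMF (α × β)) (ζ : ι → β → δ)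
    (hζ : ∀ i j x y, ζ i x = ζ j y → i = j ∧ x = y) :
    condEntropy b (p.bind fun i => (r i).map fun x => (x.1, ζ i x.2))
      = ∑' i, p i * condEntropy b (r i) := by
  classical
  set R := p.bind fun i => (r i).map fun x => (x.1, ζ i x.2) with hR
  -- both laws carry the factor `p i`, which cancels in the quotient
  have h1 : ∀ i x, R (x.1, ζ i x.2) = p i * r i x := by
    intro i x
    rw [hR, PMF.bind_apply, tsum_eq_single i]
    · congr 1
      rw [PMF.map_apply, tsum_eq_single x]
      · simp
      · rintro ⟨y1, y2⟩ hy
        rw [if_neg]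
        intro h
        rw [Prod.mk.injEq] at h
        exact hy (Prod.ext h.1.symm (hζ _ _ _ _ h.2).2.symm)
    · intro j hj
      rw [PMF.map_apply, ENNReal.tsum_eq_zero.2, mul_zero]
      intro y
      rw [if_neg]
      intro h
      rw [Prod.mk.injEq] at h
      exact hj (hζ _ _ _ _ h.2).1.symm
  have h2 : ∀ i z, R.map Prod.snd (ζ i z) = p i * (r i).map Prod.snd z := by
    intro i z
    rw [hR, PMF.map_bind, PMF.bind_apply, tsum_eq_single i]
    · congr 1
      rw [PMF.map_comp, PMF.map_apply, PMF.map_apply]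
      refine tsum_congr fun y => ?_
      have : ζ i z = ζ i y.2 ↔ z = y.2 := ⟨fun h => (hζ _ _ _ _ h).2, fun h => h ▸ rfl⟩
      simp [this]
    · intro j hj
      rw [PMF.map_comp, PMF.map_apply, ENNReal.tsum_eq_zero.2, mul_zero]
      intro y
      rw [if_neg]
      intro h
      exact hj (hζ _ _ _ _ h).1.symm
  rw [condEntropy_eq_tsum]
  nth_rewrite 1 [hR]
  rw [tsum_bind_mul p _ fun x => ENNReal.ofReal
      (Real.logb b ((R.map Prod.snd x.2).toReal / (R x).toReal))]
  refine tsum_mul_congr p fun i hi => ?_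
  rw [tsum_map_mul (r i) _ fun x => ENNReal.ofReal
      (Real.logb b ((R.map Prod.snd x.2).toReal / (R x).toReal)), condEntropy_eq_tsum]
  refine tsum_congr fun x => ?_
  rw [h1, h2, ENNReal.toReal_mul, ENNReal.toReal_mul, mul_div_mul_left]
  exact (ENNReal.toReal_pos ((p.mem_support_iff i).1 hi) (p.apply_ne_top i)).ne'

/-- Every value between `0` and the maximal entropy `log_b |α|` is the entropy of some law
on `α`. -/
theorem exists_entropy_eq (hb : 1 < b) [Fintype α] [Nonempty α] {h : ℝ} (h0 : 0 ≤ h)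
    (h1 : h ≤ Real.logb b (Fintype.card α)) : ∃ p : PMF α, entropy b p = ENNReal.ofReal h := by
  classical
  obtain ⟨a₀⟩ := ‹Nonempty α›
  have hcard : (0 : ℝ) < Fintype.card α := by exact_mod_cast Fintype.card_pos_iff.2 ⟨a₀⟩
  -- the segment from a point mass to the uniform law
  let w : ℝ → α → ℝ := fun θ a => (1 - θ) * (if a = a₀ then 1 else 0) + θ / Fintype.card α
  let H : ℝ → ℝ := fun θ => ∑ a, Real.negMulLog (w θ a) / Real.log b
  have hH : Continuous H := by
    refine continuous_finsetSum _ fun a _ => (Real.continuous_negMulLog.comp ?_).div_const _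
    fun_prop
  have hH0 : H 0 = 0 := by
    refine Finset.sum_eq_zero fun a _ => ?_
    simp only [w]
    split_ifs <;> simp
  have hH1 : H 1 = Real.logb b (Fintype.card α) := by
    simp only [H, w, Real.negMulLog, Real.logb]
    simp
    field_simp
  obtain ⟨θ, ⟨hθ0, hθ1⟩, hθ⟩ := intermediate_value_Icc zero_le_one hH.continuousOn
    (show h ∈ Set.Icc (H 0) (H 1) from ⟨by rwa [hH0], by rwa [hH1]⟩)
  have hw0 : ∀ a, 0 ≤ w θ a := fun a => by
    have : 0 ≤ 1 - θ := by linarith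
    simp only [w]; positivity
  have hw1 : ∑ a, w θ a = 1 := by
    simp only [w, Finset.sum_add_distrib, ← Finset.mul_sum]
    simp
    field_simp
    ring
  refine ⟨PMF.ofFintype (fun a => ENNReal.ofReal (w θ a)) ?_, ?_⟩
  · rw [← ENNReal.ofReal_sum_of_nonneg fun a _ => hw0 a, hw1, ENNReal.ofReal_one]
  · have hnn : ∀ a ∈ Finset.univ, 0 ≤ Real.negMulLog (w θ a) / Real.log b := fun a _ => by
      refine div_nonneg (Real.negMulLog_nonneg (hw0 a) ?_) (Real.log_pos hb).le
      rw [← hw1]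
      exact Finset.single_le_sum (fun a _ => hw0 a) (Finset.mem_univ a)
    rw [← hθ, entropy, tsum_fintype, ENNReal.ofReal_sum_of_nonneg hnn]
    refine Finset.sum_congr rfl fun a _ => ?_
    rw [PMF.ofFintype_apply, ENNReal.toReal_ofReal (hw0 a)]

end Entropy

/-! ### Entropy given some of the messages -/

section Conditional

variable {ι M S β : Type*} [Fintype ι] [DecidableEq ι] [Fintype M] [Nonempty M] {b : ℝ}

/-- Resampling one coordinate of a uniform vector leaves it uniform. -/
theorem uniform_resample (j : ι) :
    ((PMF.uniformOfFintype M).bind fun v =>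
      (PMF.uniformOfFintype (ι → M)).map fun w => Function.update w j v)
      = PMF.uniformOfFintype (ι → M) := by
  -- `(v, w) ↦ (w j, w with v at j)` is an involution of `M × (ι → M)`
  let σ : M × (ι → M) ≃ M × (ι → M) := Function.Involutive.toPerm
    (fun x => (x.2 j, Function.update x.2 j x.1)) (fun x => by simp)
  have h := congrArg (PMF.map Prod.snd) (uniform_map_equiv σ)
  rw [PMF.map_comp, ← prodLaw_uniform, prodLaw_map_snd, map_prodLaw] at h
  exact h

theorem uniform_map_restrict (p : ι → Prop) [DecidablePred p] :
    (PMF.uniformOfFintype (ι → M)).map (fun w (j : {j // p j}) => w j)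
      = PMF.uniformOfFintype ({j // p j} → M) := by
  have h := congrArg (PMF.map Prod.fst)
    (uniform_map_equiv (Equiv.piEquivPiSubtypeProd p fun _ : ι => M))
  rw [PMF.map_comp, ← prodLaw_uniform, prodLaw_map_fst] at h
  exact h

/-- The law of `g(W, S)` given the coordinates `W_T = w_T` of a uniform vector `W`, where `S` has
the law `ν` and is independent of `W`. -/
def partialLaw (ν : PMF S) (T : Finset ι) (g : (ι → M) → S → β) (w : ι → M) : PMF β :=
  (prodLaw (PMF.uniformOfFintype (ι → M)) ν).map fun x => g (T.piecewise w x.1) x.2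

/-- The conditional entropy `H(g(W, S) | W_T)` for a uniform vector `W` and an independent `S` of
law `ν`. -/
def partialEntropy (b : ℝ) (ν : PMF S) (T : Finset ι) (g : (ι → M) → S → β) : ℝ≥0∞ :=
  ∑' w, PMF.uniformOfFintype (ι → M) w * entropy b (partialLaw ν T g w)

theorem partialLaw_empty (ν : PMF S) (g : (ι → M) → S → β) (w : ι → M) :
    partialLaw ν ∅ g w = (prodLaw (PMF.uniformOfFintype (ι → M)) ν).map fun x => g x.1 x.2 := by
  simp [partialLaw]

theorem partialLaw_univ (ν : PMF S) (g : (ι → M) → S → β) (w : ι → M) :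
    partialLaw ν Finset.univ g w = ν.map (g w) := by
  simp only [partialLaw, Finset.piecewise_univ]
  rw [map_prodLaw]
  exact PMF.bind_const _ (ν.map (g w))

theorem partialEntropy_empty (ν : PMF S) (g : (ι → M) → S → β) :
    partialEntropy b ν ∅ g
      = entropy b ((prodLaw (PMF.uniformOfFintype (ι → M)) ν).map fun x => g x.1 x.2) := by
  simp_rw [partialEntropy, partialLaw_empty, tsum_const_mul]

theorem partialEntropy_univ (ν : PMF S) (g : (ι → M) → S → β) :
    partialEntropy b ν Finset.univ g
      = ∑' w, PMF.uniformOfFintype (ι → M) w * entropy b (ν.map (g w)) := by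
  simp_rw [partialEntropy, partialLaw_univ]

theorem partialEntropy_univ_le (hb : 1 < b) (ν : PMF S) (g : (ι → M) → S → β) :
    partialEntropy b ν Finset.univ g ≤ entropy b ν := by
  rw [partialEntropy_univ, ← tsum_const_mul (PMF.uniformOfFintype (ι → M)) (entropy b ν)]
  exact tsum_mul_le_tsum_mul _ fun w _ => entropy_map_le hb ν (g w)

theorem partialEntropy_comp_le (hb : 1 < b) {γ : Type*} (ν : PMF S) (T : Finset ι)
    (g : (ι → M) → S → β) (φ : β → γ) :
    partialEntropy b ν T (fun w c => φ (g w c)) ≤ partialEntropy b ν T g := by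
  refine tsum_mul_le_tsum_mul _ fun w _ => ?_
  have : partialLaw ν T (fun w c => φ (g w c)) w = (partialLaw ν T g w).map φ := by
    rw [partialLaw, partialLaw, PMF.map_comp]; rfl
  rw [this]
  exact entropy_map_le hb _ _

theorem partialEntropy_pi_le (hb : 1 < b) {n : ℕ} (ν : PMF S) (T : Finset ι)
    (g : Fin n → (ι → M) → S → β) :
    partialEntropy b ν T (fun w c i => g i w c) ≤ ∑ i, partialEntropy b ν T (g i) := by
  simp_rw [partialEntropy]
  rw [← Summable.tsum_finsetSum fun _ _ => ENNReal.summable]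
  simp_rw [← Finset.mul_sum]
  exact tsum_mul_le_tsum_mul _ fun w _ => entropy_pi_le hb _ _

/-- Revealing a coordinate that `g(W, S)` determines lowers the conditional entropy by exactly
the entropy of that coordinate. -/
theorem partialEntropy_insert (hb : 1 < b) (ν : PMF S) {T : Finset ι} {j : ι} (hj : j ∉ T)
    (g : (ι → M) → S → β) (d : β → M) (hd : ∀ w, ∀ c ∈ ν.support, d (g w c) = w j) :
    partialEntropy b ν T g
      = ENNReal.ofReal (Real.logb b (Fintype.card M)) + partialEntropy b ν (insert j T) g := by
  have hlaw : ∀ w, partialLaw ν T g w = (PMF.uniformOfFintype M).bind fun v =>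
      partialLaw ν (insert j T) g (Function.update w j v) := by
    intro w
    simp only [partialLaw, map_prodLaw]
    nth_rewrite 1 [← uniform_resample j]
    rw [PMF.bind_bind]
    congr 1
    funext v
    rw [PMF.bind_map]
    congr 1
    funext w'
    simp only [Function.comp_apply]
    congr 1
    funext c
    congr 1
    funext i
    by_cases hi : i = j
    · subst hi; simp [hj]
    · by_cases hT : i ∈ T <;> simp [Finset.piecewise, hi, hT]
  have h1 : ∀ w, entropy b (partialLaw ν T g w) = ENNReal.ofReal (Real.logb b (Fintype.card M))
      + ∑' v, PMF.uniformOfFintype M v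
        * entropy b (partialLaw ν (insert j T) g (Function.update w j v)) := by
    intro w
    rw [hlaw, entropy_uniform_bind hb _ d]
    intro v a ha
    rw [partialLaw, PMF.support_map] at ha
    obtain ⟨⟨w', c⟩, hx, rfl⟩ := ha
    rw [PMF.mem_support_iff, prodLaw_apply] at hx
    rw [hd _ _ ((PMF.mem_support_iff _ _).2 (right_ne_zero_of_mul hx))]
    simp
  simp_rw [partialEntropy, h1, mul_add]
  rw [ENNReal.tsum_add, tsum_const_mul]
  congr 1
  conv_rhs => rw [← uniform_resample j]
  rw [tsum_bind_mul _ _ fun w => entropy b (partialLaw ν (insert j T) g w)]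
  simp_rw [tsum_map_mul _ _ fun w => entropy b (partialLaw ν (insert j T) g w)]
  simp_rw [← ENNReal.tsum_mul_left]
  rw [ENNReal.tsum_comm]
  refine tsum_congr fun v => tsum_congr fun w => ?_
  ring

end Conditional

/-! ### Entropy of the answers, and total leakage -/

namespace Scheme

variable {N K L : ℕ} {X : Type*} [Fintype X] [Nontrivial X]

theorem one_lt_card : (1 : ℝ) < (Fintype.card X : ℝ) := by exact_mod_cast Fintype.one_lt_card

theorem logb_card_pi {ι : Type*} [Fintype ι] [DecidableEq ι] :
    Real.logb (Fintype.card X) (Fintype.card (ι → X)) = Fintype.card ι := by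
  rw [Fintype.card_fun, Nat.cast_pow, Real.logb_pow,
    Real.logb_self_eq_one one_lt_card, mul_one]

/-- All the answers, for the desired index `k` and the key `f`. -/
def answers (C : Scheme N K L X) (k : Fin K) (f : C.Key) (w : Messages K L X) (c : C.Com) :
    Fin N → List C.Sym :=
  fun n => C.answer n (C.query n k f) w c

/-- `H(A_{1:N}^{[k]} | F, W_T)`. -/
def answersEntropy (C : Scheme N K L X) (k : Fin K) (T : Finset (Fin K)) : ℝ≥0∞ :=
  ∑' f, C.keyLaw f * partialEntropy (Fintype.card X) C.comLaw T (C.answers k f)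

/-- `H(A_n^{[k]} | F, W_T)`. -/
def answerEntropy (C : Scheme N K L X) (n : Fin N) (k : Fin K) (T : Finset (Fin K)) : ℝ≥0∞ :=
  ∑' f, C.keyLaw f * partialEntropy (Fintype.card X) C.comLaw T (C.answer n (C.query n k f))

/-- By privacy, a single answer does not reveal the desired index. -/
theorem answerEntropy_eq (C : Scheme N K L X) (n : Fin N) (k k' : Fin K) (T : Finset (Fin K)) :
    C.answerEntropy n k T = C.answerEntropy n k' T := by
  have h : ∀ k, C.answerEntropy n k T = ∑' q, (C.keyLaw.map (C.query n k)) q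
      * partialEntropy (Fintype.card X) C.comLaw T (C.answer n q) := fun k => by
    rw [tsum_map_mul _ _ fun q => partialEntropy (Fintype.card X) C.comLaw T (C.answer n q)]
    rfl
  rw [h, h, C.privacy n k k']

theorem answerEntropy_le (C : Scheme N K L X) (n : Fin N) (k : Fin K) (T : Finset (Fin K)) :
    C.answerEntropy n k T ≤ C.answersEntropy k T :=
  tsum_mul_le_tsum_mul _ fun f _ =>
    partialEntropy_comp_le one_lt_card C.comLaw T (C.answers k f) fun a => a n

theorem answersEntropy_le_sum (C : Scheme N K L X) (k : Fin K) (T : Finset (Fin K)) :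
    C.answersEntropy k T ≤ ∑ n, C.answerEntropy n k T := by
  simp_rw [answerEntropy]
  rw [← Summable.tsum_finsetSum fun _ _ => ENNReal.summable]
  simp_rw [← Finset.mul_sum]
  exact tsum_mul_le_tsum_mul _ fun f _ => partialEntropy_pi_le one_lt_card C.comLaw T _

theorem answersEntropy_le_mul (C : Scheme N K L X) (k k' : Fin K) (T : Finset (Fin K)) :
    C.answersEntropy k' T ≤ N * C.answersEntropy k T := by
  refine (C.answersEntropy_le_sum k' T).trans ?_
  refine (Finset.sum_le_sum fun n _ => (C.answerEntropy_eq n k' k T).le.trans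
    (C.answerEntropy_le n k T)).trans ?_
  simp

theorem answersEntropy_insert (C : Scheme N K L X) {k : Fin K} {T : Finset (Fin K)}
    (hk : k ∉ T) : C.answersEntropy k T = L + C.answersEntropy k (insert k T) := by
  rw [answersEntropy, answersEntropy, ← tsum_const_mul C.keyLaw (L : ℝ≥0∞), ← ENNReal.tsum_add]
  simp_rw [← mul_add]
  refine tsum_mul_congr _ fun f hf => ?_
  rw [partialEntropy_insert one_lt_card C.comLaw hk (C.answers k f) (C.decode k f)
    fun w c hc => C.decode_eq k f hf w c hc, logb_card_pi]
  simp

theorem answersEntropy_univ_le (C : Scheme N K L X) (k : Fin K) :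
    C.answersEntropy k Finset.univ ≤ C.commonEntropy := by
  rw [answersEntropy, commonEntropy, ← tsum_const_mul C.keyLaw (entropy _ _)]
  exact tsum_mul_le_tsum_mul _ fun f _ => partialEntropy_univ_le one_lt_card _ _

theorem answersEntropy_empty_le (C : Scheme N K L X) (k : Fin K) :
    C.answersEntropy k ∅ ≤ C.downloadCost k := by
  classical
  refine (C.answersEntropy_le_sum k ∅).trans ?_
  rw [downloadCost, Finset.mul_sum]
  refine Finset.sum_le_sum fun n _ => ?_
  rw [← ENNReal.tsum_mul_left, answerEntropy]
  refine ENNReal.tsum_le_tsum fun f => ?_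
  rw [mul_left_comm, partialEntropy_empty]
  gcongr
  refine (entropy_le_of_support one_lt_card _
    ((Finset.univ : Finset (Fin (C.len n (C.query n k f)) → C.Sym)).image List.ofFn) ?_).trans ?_
  · intro a ha
    rw [PMF.support_map] at ha
    obtain ⟨x, -, rfl⟩ := ha
    have hl := C.length_answer n (C.query n k f) x.1 x.2
    rw [← hl]
    exact Finset.mem_image.2 ⟨_, Finset.mem_univ _, List.ofFn_get _⟩
  · rw [Finset.card_image_of_injective _ List.ofFn_injective, Finset.card_univ, Fintype.card_fun,
      Fintype.card_fin, Nat.cast_pow, Real.logb_pow, ENNReal.ofReal_mul (Nat.cast_nonneg _),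
      ENNReal.ofReal_natCast, mul_comm]

/-- The Sun–Jafar induction: each of the `K - |T|` remaining messages is forced into the answers,
at the price of a factor `N` each. -/
theorem le_answersEntropy (C : Scheme N K L X) (y : ℝ≥0∞)
    (hy : ∀ k, y ≤ C.answersEntropy k Finset.univ) :
    ∀ (r : ℕ) (T : Finset (Fin K)) (k : Fin K), T.card + r = K →
      L * ∑ i ∈ Finset.range r, (N : ℝ≥0∞) ^ i + y
        ≤ N ^ r * C.answersEntropy k T := by
  intro r
  induction r with
  | zero =>
    intro T k hT
    have : T = Finset.univ := by
      rw [← Finset.card_eq_iff_eq_univ, Fintype.card_fin]; omega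
    subst this
    simpa using hy k
  | succ r ih =>
    intro T k hT
    obtain ⟨j, hj⟩ : ∃ j, j ∉ T := by
      by_contra h
      push Not at h
      have : T = Finset.univ := Finset.eq_univ_iff_forall.2 h
      rw [this, Finset.card_univ, Fintype.card_fin] at hT
      omega
    have h1 := ih (insert j T) j (by rw [Finset.card_insert_of_notMem hj]; omega)
    calc _ = L * (N : ℝ≥0∞) ^ r
          + (L * ∑ i ∈ Finset.range r, (N : ℝ≥0∞) ^ i + y) := by
          rw [Finset.sum_range_succ]; ring
      _ ≤ L * (N : ℝ≥0∞) ^ r + N ^ r * C.answersEntropy j (insert j T) := by gcongr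
      _ = N ^ r * C.answersEntropy j T := by rw [C.answersEntropy_insert hj]; ring
      _ ≤ N ^ r * (N * C.answersEntropy k T) := by gcongr; exact C.answersEntropy_le_mul k j T
      _ = _ := by ring

/-- The uncertainty `H((W_j)_{j ≠ k} | F, Q, A)` that remains about the undesired messages. -/
def undesiredEntropy (C : Scheme N K L X) (k : Fin K) : ℝ≥0∞ :=
  condEntropy (Fintype.card X) (C.jointLaw.map fun x =>
    ((fun j : {j : Fin K // j ≠ k} => x.1 j), C.view k x))

theorem jointLaw_map_fst (C : Scheme N K L X) :
    C.jointLaw.map Prod.fst = PMF.uniformOfFintype (Messages K L X) := by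
  rw [jointLaw, PMF.map_bind]
  refine (congrArg _ (funext fun w => ?_)).trans (PMF.bind_pure _)
  rw [PMF.map_bind]
  simp_rw [PMF.map_comp]
  refine (congrArg _ (funext fun f => PMF.map_const C.comLaw w)).trans (PMF.bind_const _ _)

theorem totalLeakage_eq (C : Scheme N K L X) (k : Fin K) :
    C.totalLeakage k = ((K - 1) * L : ℕ) - C.undesiredEntropy k := by
  classical
  rw [totalLeakage, mutualInfo, undesiredEntropy]
  congr 1
  rw [PMF.map_comp]
  have : (Prod.fst ∘ fun x : Messages K L X × C.Key × C.Com =>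
      ((fun j : {j : Fin K // j ≠ k} => x.1 j), C.view k x))
      = (fun (w : Messages K L X) (j : {j : Fin K // j ≠ k}) => w j) ∘ Prod.fst := rfl
  rw [this, ← PMF.map_comp, jointLaw_map_fst, uniform_map_restrict, entropy_uniform,
    Fintype.card_fun, Nat.cast_pow, Real.logb_pow, logb_card_pi]
  simp only [Fintype.card_fin, ne_eq, Fintype.card_subtype_compl, Fintype.card_unique]
  exact_mod_cast ENNReal.ofReal_natCast ((K - 1) * L)

/-- `H(W_{≠ k} | F, Q, A) + H(A | F) = H(W, A | F)`, since `A` and `F` determine `W_k`. -/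
theorem undesiredEntropy_add (C : Scheme N K L X) (k : Fin K) :
    C.undesiredEntropy k + C.answersEntropy k ∅
      = (K * L : ℕ) + C.answersEntropy k Finset.univ := by
  classical
  set U := PMF.uniformOfFintype (Messages K L X)
  let r : C.Key → PMF (({j : Fin K // j ≠ k} → Fin L → X) × (Fin N → List C.Sym)) := fun f =>
    (prodLaw U C.comLaw).map fun x => ((fun j => x.1 j), C.answers k f x.1 x.2)
  have hr : (C.jointLaw.map fun x => ((fun j : {j : Fin K // j ≠ k} => x.1 j), C.view k x))
      = C.keyLaw.bind fun f => (r f).map fun x => (x.1, (f, (fun n => C.query n k f), x.2)) := by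
    simp only [r, PMF.map_comp]
    simp only [map_prodLaw]
    rw [PMF.bind_comm, jointLaw, PMF.map_bind]
    congr 1
    funext w
    rw [PMF.map_bind]
    congr 1
    funext f
    rw [PMF.map_comp]
    rfl
  rw [undesiredEntropy, hr, condEntropy_bind C.keyLaw r
    (fun f a => (f, (fun n => C.query n k f), a)) (by
      intro f f' a a' h
      simp only [Prod.mk.injEq] at h
      exact ⟨h.1, h.2.2⟩), answersEntropy, answersEntropy,
    ← tsum_const_mul C.keyLaw ((K * L : ℕ) : ℝ≥0∞), ← ENNReal.tsum_add, ← ENNReal.tsum_add]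
  simp_rw [← mul_add]
  refine tsum_mul_congr _ fun f hf => ?_
  have h1 : partialEntropy (Fintype.card X) C.comLaw ∅ (C.answers k f)
      = entropy (Fintype.card X) ((r f).map Prod.snd) := by
    rw [partialEntropy_empty, PMF.map_comp]
    rfl
  rw [h1, condEntropy_add_entropy one_lt_card]
  have h2 : r f = U.bind fun w => C.comLaw.map fun c =>
      ((fun j : {j : Fin K // j ≠ k} => w j), C.answers k f w c) := map_prodLaw _ _ _
  rw [h2, entropy_uniform_bind one_lt_card _
    fun a j => if h : j ≠ k then a.1 ⟨j, h⟩ else C.decode k f a.2]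
  · rw [partialEntropy_univ, Fintype.card_fun, Nat.cast_pow, Real.logb_pow, logb_card_pi]
    congr 1
    · simp only [Fintype.card_fin]
      exact_mod_cast ENNReal.ofReal_natCast (K * L)
    · refine tsum_congr fun w => ?_
      congr 1
      have : (C.comLaw.map fun c => ((fun j : {j : Fin K // j ≠ k} => w j), C.answers k f w c))
          = (C.comLaw.map (C.answers k f w)).map
            (Prod.mk fun j : {j : Fin K // j ≠ k} => w j) := by
        rw [PMF.map_comp]; rfl
      rw [this, entropy_map_of_injOn _ _ (Prod.mk_right_injective _).injOn]
  · intro w a ha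
    rw [PMF.support_map] at ha
    obtain ⟨c, hc, rfl⟩ := ha
    funext j
    by_cases h : j = k
    · subst h
      rw [dif_neg (by simp)]
      exact C.decode_eq j f hf w c hc
    · simp [h]

/-- The total leakage is `H(A | F, W_k) - H(A | F, W_{1:K})`. -/
theorem totalLeakage_le_iff (C : Scheme N K L X) (k : Fin K) {t : ℝ≥0∞}
    (hfin : C.answersEntropy k Finset.univ ≠ ∞) :
    C.totalLeakage k ≤ t ↔ C.answersEntropy k {k} ≤ t + C.answersEntropy k Finset.univ := by
  have h := C.undesiredEntropy_add k
  have h0 := C.answersEntropy_insert (Finset.notMem_empty k)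
  rw [insert_empty_eq] at h0
  have hKL : ((K * L : ℕ) : ℝ≥0∞) = ((K - 1) * L : ℕ) + L := by
    rw [← Nat.cast_add]
    congr 1
    obtain ⟨m, rfl⟩ : ∃ m, K = m + 1 := ⟨K - 1, by have := k.isLt; omega⟩
    simp; ring
  have hsum : ((K * L : ℕ) : ℝ≥0∞) + C.answersEntropy k Finset.univ ≠ ∞ :=
    ENNReal.add_ne_top.2 ⟨ENNReal.natCast_ne_top _, hfin⟩
  rw [← h] at hsum
  obtain ⟨hu, hx⟩ := ENNReal.add_ne_top.1 hsum
  rw [totalLeakage_eq, tsub_le_iff_right]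
  rw [h0, hKL] at h
  rw [h0] at hx
  have hx' := (ENNReal.add_ne_top.1 hx).2
  have h' : C.undesiredEntropy k + C.answersEntropy k {k}
      = ((K - 1) * L : ℕ) + C.answersEntropy k Finset.univ := by
    refine (ENNReal.add_left_inj (ENNReal.natCast_ne_top L)).1 ?_
    rw [add_assoc, add_comm _ (L : ℝ≥0∞), h]
    ring
  constructor
  · intro hle
    refine (ENNReal.add_le_add_iff_left hu).1 ?_
    rw [h', ← add_assoc, add_comm _ t]
    gcongr
  · intro hle
    refine (ENNReal.add_le_add_iff_right hfin).1 ?_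
    rw [← h', add_comm t, add_assoc]
    gcongr

/-- The entropies `x = H(A | F, W_k)` and `y = H(A | F, W_{1:K})`, for an index `k` that minimizes
`y`, satisfy the linear inequalities from which all the lower bounds follow. -/
theorem exists_entropy_bounds (C : Scheme N K L X) (hK : 1 ≤ K) {s ρ : ℝ} (hs : 0 ≤ s)
    (hρ : 0 ≤ ρ) (hleak : ∀ k, C.totalLeakage k ≤ ENNReal.ofReal (s * L))
    (hcom : C.commonEntropy = ENNReal.ofReal (ρ * L)) :
    ∃ (k : Fin K) (x y : ℝ), y ≤ ρ * L ∧ x ≤ s * L + y ∧ 0 ≤ y ∧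
      L * ∑ i ∈ Finset.range (K - 1), (N : ℝ) ^ i + y ≤ (N : ℝ) ^ (K - 1) * x ∧
      ENNReal.ofReal (L + x) ≤ C.downloadCost k := by
  have : Nonempty (Fin K) := ⟨⟨0, hK⟩⟩
  obtain ⟨k, hk⟩ := Finite.exists_min fun k => C.answersEntropy k Finset.univ
  have hy := C.answersEntropy_univ_le k
  rw [hcom] at hy
  have hyt : C.answersEntropy k Finset.univ ≠ ∞ := ne_top_of_le_ne_top ENNReal.ofReal_ne_top hy
  have hx := (C.totalLeakage_le_iff k hyt).1 (hleak k)
  have hxt : C.answersEntropy k {k} ≠ ∞ :=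
    ne_top_of_le_ne_top (ENNReal.add_ne_top.2 ⟨ENNReal.ofReal_ne_top, hyt⟩) hx
  have hind := C.le_answersEntropy _ hk (K - 1) {k} k (by rw [Finset.card_singleton]; omega)
  have hD := C.answersEntropy_empty_le k
  rw [C.answersEntropy_insert (Finset.notMem_empty k), insert_empty_eq] at hD
  refine ⟨k, (C.answersEntropy k {k}).toReal, (C.answersEntropy k Finset.univ).toReal,
    ?_, ?_, ENNReal.toReal_nonneg, ?_, ?_⟩
  · exact ENNReal.toReal_le_of_le_ofReal (by positivity) hy
  · have := ENNReal.toReal_mono (ENNReal.add_ne_top.2 ⟨ENNReal.ofReal_ne_top, hyt⟩) hx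
    rwa [ENNReal.toReal_add ENNReal.ofReal_ne_top hyt, ENNReal.toReal_ofReal (by positivity)]
      at this
  · have := ENNReal.toReal_mono (ENNReal.mul_ne_top
      (ENNReal.pow_ne_top (ENNReal.natCast_ne_top N)) hxt) hind
    rw [ENNReal.toReal_add (ENNReal.mul_ne_top (ENNReal.natCast_ne_top L)
      (ENNReal.sum_ne_top.2 fun i _ => ENNReal.pow_ne_top (ENNReal.natCast_ne_top N))) hyt,
      ENNReal.toReal_mul, ENNReal.toReal_mul, ENNReal.toReal_sum fun i _ =>
        ENNReal.pow_ne_top (ENNReal.natCast_ne_top N)] at this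
    simpa using this
  · rwa [ENNReal.ofReal_add (Nat.cast_nonneg _) ENNReal.toReal_nonneg, ENNReal.ofReal_natCast,
      ENNReal.ofReal_toReal hxt]

end Scheme

/-! ### The optimal rate in closed form -/

section Parameters

variable {N K : ℕ}

theorem one_lt_pow_pred (hN : 2 ≤ N) (hK : 2 ≤ K) : (1 : ℝ) < (N : ℝ) ^ (K - 1) :=
  one_lt_pow₀ (by exact_mod_cast hN) (by omega)

theorem sum_range_pow (hN : 2 ≤ N) :
    ∑ i ∈ Finset.range (K - 1), (N : ℝ) ^ i = ((N : ℝ) ^ (K - 1) - 1) / ((N : ℝ) - 1) :=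
  geom_sum_eq (by norm_cast; omega) _

theorem sum_range_inv_pow (hN : 2 ≤ N) (hK : 2 ≤ K) :
    ∑ i ∈ Finset.range K, 1 / (N : ℝ) ^ i
      = 1 + 1 / ((N : ℝ) - 1) * (1 - 1 / (N : ℝ) ^ (K - 1)) := by
  obtain ⟨n, rfl⟩ : ∃ n, K = n + 1 := ⟨K - 1, by omega⟩
  have h2 : (2 : ℝ) ≤ N := by exact_mod_cast hN
  have h1 : (N : ℝ) - 1 ≠ 0 := by linarith
  have h0 : (N : ℝ) ≠ 0 := by linarith
  clear hK
  simp only [Nat.add_sub_cancel]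
  induction n with
  | zero => simp
  | succ n ih =>
    rw [Finset.sum_range_succ, ih]
    field_simp
    ring

theorem optRate_of_le {s : ℝ} (h : s ≤ threshold N K) :
    optRate N K s = (N : ℝ) / ((N : ℝ) - 1) - 1 / ((N : ℝ) ^ (K - 1) - 1) * s := if_pos h

theorem optRate_of_lt {s : ℝ} (hN : 2 ≤ N) (hK : 2 ≤ K) (h : threshold N K < s) :
    optRate N K s = 1 + threshold N K := (if_neg h.not_ge).trans (sum_range_inv_pow hN hK)

end Parameters

/-! ### Lower bounds -/

section Converse

variable {N K L : ℕ} {X : Type*} [Fintype X] [Nontrivial X]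

theorem Scheme.optRate_le_and_rhoMin_le (C : Scheme N K L X) (hN : 2 ≤ N) (hK : 2 ≤ K)
    (hL : 1 ≤ L) {s ρ : ℝ} (hs : 0 ≤ s) (hρ : 0 ≤ ρ)
    (hleak : ∀ k, C.totalLeakage k ≤ ENNReal.ofReal (s * L))
    (hcom : C.commonEntropy = ENNReal.ofReal (ρ * L)) :
    (∃ k, ENNReal.ofReal (L * optRate N K s) ≤ C.downloadCost k) ∧ rhoMin N K s ≤ ρ := by
  obtain ⟨k, x, y, hyρ, hxy, hy0, hind, hD⟩ :=
    C.exists_entropy_bounds (by omega) hs hρ hleak hcom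
  have ha := one_lt_pow_pred hN hK
  rw [sum_range_pow hN] at hind
  have hN1 : (0 : ℝ) < (N : ℝ) - 1 := by
    have : (2 : ℝ) ≤ N := by exact_mod_cast hN
    linarith
  have hL0 : (0 : ℝ) < L := by exact_mod_cast hL
  set a := (N : ℝ) ^ (K - 1) with ha_def
  have ha1 : 0 < a - 1 := by linarith
  have ha0 : 0 < a := by linarith
  -- eliminating `y` from the induction and the leakage bound
  have hx : L * (1 / ((N : ℝ) - 1) - 1 / (a - 1) * s) ≤ x := by
    have h : (a - 1) * (L * (1 / ((N : ℝ) - 1) - 1 / (a - 1) * s)) ≤ (a - 1) * x := by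
      have e : (a - 1) * (L * (1 / ((N : ℝ) - 1) - 1 / (a - 1) * s))
          = L * ((a - 1) / ((N : ℝ) - 1)) - s * L := by field_simp
      rw [e]; linarith
    exact le_of_mul_le_mul_left h ha1
  refine ⟨⟨k, le_trans (ENNReal.ofReal_le_ofReal ?_) hD⟩, ?_⟩
  · rcases le_or_gt s (threshold N K) with h | h
    · rw [optRate_of_le h, ← ha_def]
      have e : (N : ℝ) / ((N : ℝ) - 1) = 1 + 1 / ((N : ℝ) - 1) := by field_simp; ring
      rw [e]; linarith
    · rw [optRate_of_lt hN hK h, threshold, ← ha_def]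
      have h2 : a * (L * (1 / ((N : ℝ) - 1) * (1 - 1 / a))) ≤ a * x := by
        have e : a * (L * (1 / ((N : ℝ) - 1) * (1 - 1 / a)))
            = L * ((a - 1) / ((N : ℝ) - 1)) := by field_simp
        rw [e]; linarith
      have := le_of_mul_le_mul_left h2 ha0
      linarith
  · have h2 : L * rhoMin N K s ≤ L * ρ := by
      have e : L * rhoMin N K s = L * (1 / ((N : ℝ) - 1) - 1 / (a - 1) * s) - s * L := by
        rw [rhoMin, ← ha_def]; field_simp; ring
      rw [e]; linarith
    exact le_of_mul_le_mul_left h2 hL0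

theorem le_minCost (hN : 2 ≤ N) (hK : 2 ≤ K) (hL : 1 ≤ L) {s ρ : ℝ} (hs : 0 ≤ s) (hρ : 0 ≤ ρ) :
    ENNReal.ofReal (L * optRate N K s) ≤ minCost N K L X s ρ := by
  refine le_sInf ?_
  rintro D ⟨C, hleak, hcom, hD⟩
  obtain ⟨⟨k, hk⟩, -⟩ := C.optRate_le_and_rhoMin_le hN hK hL hs hρ hleak hcom
  exact hk.trans (hD k).le

theorem costs_eq_empty (hN : 2 ≤ N) (hK : 2 ≤ K) (hL : 1 ≤ L) {s ρ : ℝ} (hs : 0 ≤ s)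
    (hρ : 0 ≤ ρ) (h : ρ < rhoMin N K s) : costs N K L X s ρ = ∅ := by
  refine Set.eq_empty_of_forall_notMem ?_
  rintro D ⟨C, hleak, hcom, -⟩
  exact h.not_ge (C.optRate_le_and_rhoMin_le hN hK hL hs hρ hleak hcom).2

end Converse

/-! ### Uniform choices and biased coins -/

section Means

theorem tsum_uniform_ite {V : Type*} [Fintype V] [Nonempty V] [DecidableEq V] (v₀ : V) {A B : ℝ}
    (hA : 0 ≤ A) (hB : 0 ≤ B) :
    ∑' v, PMF.uniformOfFintype V v * ENNReal.ofReal (if v = v₀ then A else B)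
      = ENNReal.ofReal (A / Fintype.card V + (1 - 1 / Fintype.card V) * B) := by
  have hc : (0 : ℝ) < Fintype.card V := by exact_mod_cast Fintype.card_pos
  have h : ∀ v, PMF.uniformOfFintype V v * ENNReal.ofReal (if v = v₀ then A else B)
      = ENNReal.ofReal ((Fintype.card V : ℝ)⁻¹ * (if v = v₀ then A else B)) := by
    intro v
    rw [ENNReal.ofReal_mul (by positivity), ENNReal.ofReal_inv_of_pos hc, ENNReal.ofReal_natCast,
      PMF.uniformOfFintype_apply]
  rw [tsum_fintype, Finset.sum_congr rfl fun v _ => h v, ← ENNReal.ofReal_sum_of_nonneg]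
  · congr 1
    have h2 : ∀ v, (if v = v₀ then A else B) = B + (if v = v₀ then A - B else 0) := fun v => by
      split_ifs <;> ring
    rw [← Finset.mul_sum]
    simp_rw [h2]
    rw [Finset.sum_add_distrib, Finset.sum_ite_eq' Finset.univ v₀]
    simp
    field_simp
    ring
  · intro v _
    split_ifs <;> positivity

/-- The law of a coin that shows `true` with probability `p`. -/
def coin (p : ℝ) (h0 : 0 ≤ p) (h1 : p ≤ 1) : PMF Bool :=
  PMF.ofFintype (fun c => ENNReal.ofReal (if c then p else 1 - p)) (by
    simp [← ENNReal.ofReal_add h0 (sub_nonneg.2 h1)])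

theorem tsum_coin {p : ℝ} (h0 : 0 ≤ p) (h1 : p ≤ 1) {A B : ℝ} (hA : 0 ≤ A) (hB : 0 ≤ B) :
    ∑' c, coin p h0 h1 c * ENNReal.ofReal (if c then A else B)
      = ENNReal.ofReal (p * A + (1 - p) * B) := by
  have h2 : 0 ≤ 1 - p := sub_nonneg.2 h1
  rw [tsum_fintype, Fintype.sum_bool, ENNReal.ofReal_add (by positivity) (by positivity),
    ENNReal.ofReal_mul h0, ENNReal.ofReal_mul h2]
  simp [coin]

end Means

/-! ### The masked Tian–Sun–Chen scheme -/

section Construction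

variable {N K t m : ℕ} {X : Type*} [Fintype X] [Nontrivial X]

instance : NeZero (Fintype.card X) := ⟨Fintype.card_ne_zero⟩

/-- An arbitrary identification of the alphabet with a cyclic group. -/
def letterEquiv (X : Type*) [Fintype X] [Nontrivial X] : X ≃ ZMod (Fintype.card X) :=
  Fintype.equivOfCardEq (ZMod.card _).symm

/-- A message of `(N - 1) t` letters is cut into `N - 1` rows of length `t`, labelled by the nonzero
residues modulo `N`. -/
def positionEquiv (N t : ℕ) [NeZero N] : {i : ZMod N // i ≠ 0} × Fin t ≃ Fin ((N - 1) * t) :=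
  Fintype.equivOfCardEq (by simp [ZMod.card])

/-- The `i`-th row of a message; the row `0` is a dummy row of zeros. -/
def row [NeZero N] (x : Fin ((N - 1) * t) → X) (i : ZMod N) : Fin t → ZMod (Fintype.card X) :=
  fun τ => if h : i ≠ 0 then letterEquiv X (x (positionEquiv N t (⟨i, h⟩, τ))) else 0

theorem row_zero [NeZero N] (x : Fin ((N - 1) * t) → X) : row x 0 = 0 := by
  funext τ; simp [row]

/-- The sum of the rows requested by `v`, masked by the common randomness `σ` if `c` holds. -/
def maskedSum [NeZero N] (c : Bool) (v : Fin K → ZMod N) (w : Messages K ((N - 1) * t) X)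
    (σ : Fin t → ZMod (Fintype.card X)) : Fin t → ZMod (Fintype.card X) :=
  ∑ j, row (w j) (v j) + if c then σ else 0

/-- The part of an answer that does not depend on the desired message `k`. -/
def interference [NeZero N] (k : Fin K) (c : Bool) (v : Fin K → ZMod N)
    (w : Messages K ((N - 1) * t) X) (σ : Fin t → ZMod (Fintype.card X)) :
    Fin t → ZMod (Fintype.card X) :=
  ∑ j ∈ Finset.univ.erase k, row (w j) (v j) + if c then σ else 0

theorem maskedSum_add_single [NeZero N] (k : Fin K) (c : Bool) (v : Fin K → ZMod N) (i : ZMod N)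
    (w : Messages K ((N - 1) * t) X) (σ : Fin t → ZMod (Fintype.card X)) :
    maskedSum c (v + Pi.single k i) w σ = row (w k) (v k + i) + interference k c v w σ := by
  rw [maskedSum, interference, ← Finset.add_sum_erase _ _ (Finset.mem_univ k), add_assoc]
  congr 1
  · simp
  · congr 1
    refine Finset.sum_congr rfl fun j hj => ?_
    simp [Finset.ne_of_mem_erase hj]

/-- The length of the answer to the query `(c, v)`: when no row is requested, only the first `m`
entries, or none, can be nonzero. -/
def answerLength (t m : ℕ) [NeZero N] (x : Bool × (Fin K → ZMod N)) : ℕ :=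
  if x.2 = 0 then (if x.1 then m else 0) else t

theorem answerLength_le [NeZero N] (hm : m ≤ t) (x : Bool × (Fin K → ZMod N)) :
    answerLength t m x ≤ t := by
  rw [answerLength]; split_ifs <;> omega

/-- The database sends the entries of the masked sum that are not known to vanish. -/
def truncatedSum (m : ℕ) [NeZero N] (x : Bool × (Fin K → ZMod N))
    (w : Messages K ((N - 1) * t) X) (σ : Fin t → ZMod (Fintype.card X)) :
    List (ZMod (Fintype.card X)) :=
  (List.ofFn (maskedSum x.1 x.2 w σ)).take (answerLength t m x)

/-- Nothing is lost by the truncation: reading missing entries as `0` recovers the masked sum. -/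
theorem getD_truncatedSum [NeZero N] (x : Bool × (Fin K → ZMod N))
    (w : Messages K ((N - 1) * t) X) {σ : Fin t → ZMod (Fintype.card X)}
    (hσ : ∀ τ : Fin t, m ≤ τ → σ τ = 0) (τ : Fin t) :
    (truncatedSum m x w σ).getD τ 0 = maskedSum x.1 x.2 w σ τ := by
  rw [truncatedSum, List.getD_eq_getElem?_getD, List.getElem?_take]
  split_ifs with h
  · simp
  · obtain ⟨c, v⟩ := x
    have hv : v = 0 := by
      by_contra hv
      rw [answerLength, if_neg hv] at h
      exact h τ.isLt
    subst hv
    cases c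
    · simp [maskedSum, row_zero]
    · rw [answerLength, if_pos rfl, if_pos rfl] at h
      simp [maskedSum, row_zero, hσ τ (not_lt.1 h)]

/-- The database with the number `i`, whose query shifts the row of the desired message by `i`. -/
def database [NeZero N] (i : ZMod N) : Fin N := ⟨i.val, ZMod.val_lt i⟩

theorem database_cast [NeZero N] (i : ZMod N) : ((database i : ℕ) : ZMod N) = i :=
  ZMod.natCast_zmod_val i

/-- Queries are shifts of the key, so each has the law of the key. -/
theorem map_query [NeZero N] (κ : PMF Bool) (u : Fin K → ZMod N) :
    (prodLaw κ (PMF.uniformOfFintype (Fin K → ZMod N))).map (fun f => (f.1, f.2 + u))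
      = prodLaw κ (PMF.uniformOfFintype (Fin K → ZMod N)) := by
  rw [map_prodLaw]
  conv_rhs => rw [prodLaw]
  congr 1
  funext c
  conv_rhs => rw [← uniform_map_equiv (Equiv.addRight u)]
  rw [PMF.map_comp]
  rfl

/-- The Tian–Sun–Chen scheme, masked by common randomness when the coin of the user says so.
The key is a coin `c` and a uniform vector `v` of residues; the database `n` is asked for the sum
of the rows `v_j` of the messages `W_j`, `j ≠ k`, and of the row `v_k + n` of `W_k`, plus the mask `σ`
if `c` holds. The mask has the law `μ`, supported on the first `m` coordinates; `ν` is the law of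
additional common randomness, which is not used. -/
def maskedScheme [NeZero N] (hm : m ≤ t) (κ : PMF Bool)
    (μ : PMF (Fin t → ZMod (Fintype.card X)))
    (hμ : ∀ σ ∈ μ.support, ∀ τ : Fin t, m ≤ τ → σ τ = 0) {E : Type} (ν : PMF E) :
    Scheme N K ((N - 1) * t) X where
  Key := Bool × (Fin K → ZMod N)
  keyLaw := prodLaw κ (PMF.uniformOfFintype (Fin K → ZMod N))
  Com := (Fin t → ZMod (Fintype.card X)) × E
  comLaw := prodLaw μ ν
  Query _ := Bool × (Fin K → ZMod N)
  query n k f := (f.1, f.2 + Pi.single k ((n : ℕ) : ZMod N))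
  Sym := ZMod (Fintype.card X)
  len _ x := answerLength t m x
  answer _ x w c := truncatedSum m x w c.1
  length_answer _ x w c := by
    rw [truncatedSum, List.length_take, List.length_ofFn, min_eq_left (answerLength_le hm x)]
  decode k f A l :=
    let y := (positionEquiv N t).symm l
    (letterEquiv X).symm
      ((A (database (y.1 - f.2 k))).getD y.2 0 - (A (database (-f.2 k))).getD y.2 0)
  decode_eq k f _ w c hc := by
    funext l
    have hσ := hμ c.1 ((PMF.mem_support_iff _ _).2 fun h =>
      (PMF.mem_support_iff _ _).1 hc (by rw [prodLaw_apply, h, zero_mul]))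
    obtain ⟨⟨⟨i, hi⟩, τ⟩, rfl⟩ := (positionEquiv N t).surjective l
    simp only [Equiv.symm_apply_apply, getD_truncatedSum _ _ hσ, database_cast,
      maskedSum_add_single, Equiv.symm_apply_eq]
    simp [row_zero, row, hi]
  privacy n k k' := by rw [map_query, map_query]

/-- All the answers of the masked scheme, for the desired index `k` and the key `f`. -/
def maskedAnswers (m : ℕ) [NeZero N] {E : Type} (k : Fin K) (f : Bool × (Fin K → ZMod N))
    (w : Messages K ((N - 1) * t) X) (c : (Fin t → ZMod (Fintype.card X)) × E) :
    Fin N → List (ZMod (Fintype.card X)) :=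
  fun n => truncatedSum m (f.1, f.2 + Pi.single k ((n : ℕ) : ZMod N)) w c.1

section Analysis

variable [NeZero N] (μ : PMF (Fin t → ZMod (Fintype.card X)))
  {E : Type} (ν : PMF E)

theorem entropy_interference_le (k : Fin K) (c : Bool) (v : Fin K → ZMod N) :
    entropy (Fintype.card X) ((prodLaw (PMF.uniformOfFintype (Messages K ((N - 1) * t) X))
      (prodLaw μ ν)).map fun x => interference k c v x.1 x.2.1) ≤ t := by
  refine (entropy_le_log_card Scheme.one_lt_card _).trans_eq ?_
  rw [Fintype.card_fun, ZMod.card, Nat.cast_pow, Real.logb_pow,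
    Real.logb_self_eq_one Scheme.one_lt_card]
  simp

/-- If no row of the undesired messages is requested, then the interference is the mask alone. -/
theorem entropy_interference_of_eq_zero (k : Fin K) (c : Bool) (v : Fin K → ZMod N)
    (hv : ∀ j, j ≠ k → v j = 0) :
    entropy (Fintype.card X) ((prodLaw (PMF.uniformOfFintype (Messages K ((N - 1) * t) X))
      (prodLaw μ ν)).map fun x => interference k c v x.1 x.2.1)
      = if c then entropy (Fintype.card X) μ else 0 := by
  have h : ∀ w : Messages K ((N - 1) * t) X, ∀ σ,
      interference k c v w σ = if c then σ else 0 := by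
    intro w σ
    rw [interference, Finset.sum_eq_zero, zero_add]
    intro j hj
    rw [hv j (Finset.ne_of_mem_erase hj), row_zero]
  simp_rw [h]
  cases c
  · have := PMF.map_const (prodLaw (PMF.uniformOfFintype (Messages K ((N - 1) * t) X))
      (prodLaw μ ν)) (0 : Fin t → ZMod (Fintype.card X))
    simp only [Bool.false_eq_true, if_false]
    exact (congrArg _ this).trans (entropy_pure _)
  · simp only [if_true]
    have := PMF.map_comp (p := prodLaw (PMF.uniformOfFintype (Messages K ((N - 1) * t) X))
      (prodLaw μ ν)) (f := Prod.snd) (g := Prod.fst)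
    rw [prodLaw_map_snd, prodLaw_map_fst] at this
    exact congrArg _ this.symm

/-- Given `W_k` and the key, the answers are a function of the interference. -/
theorem partialEntropy_answers_le (k : Fin K) (f : Bool × (Fin K → ZMod N)) :
    partialEntropy (Fintype.card X) (prodLaw μ ν) {k}
      (maskedAnswers m k f)
      ≤ entropy (Fintype.card X) ((prodLaw (PMF.uniformOfFintype (Messages K ((N - 1) * t) X))
      (prodLaw μ ν)).map fun x => interference k f.1 f.2 x.1 x.2.1) := by
  rw [← tsum_const_mul (PMF.uniformOfFintype (Messages K ((N - 1) * t) X)) (entropy _ _)]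
  refine tsum_mul_le_tsum_mul _ fun w _ => ?_
  let Φ : (Fin t → ZMod (Fintype.card X)) → Fin N → List (ZMod (Fintype.card X)) := fun B n =>
    (List.ofFn (row (w k) (f.2 k + ((n : ℕ) : ZMod N)) + B)).take
      (answerLength t m (f.1, f.2 + Pi.single k ((n : ℕ) : ZMod N)))
  have : partialLaw (prodLaw μ ν) {k} (maskedAnswers m k f) w
      = ((prodLaw (PMF.uniformOfFintype (Messages K ((N - 1) * t) X))
      (prodLaw μ ν)).map fun x => interference k f.1 f.2 x.1 x.2.1).map Φ := by
    rw [partialLaw, PMF.map_comp]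
    congr 1
    funext x n
    simp only [maskedAnswers, truncatedSum, maskedSum_add_single, Φ,
      Function.comp_apply]
    have hB : interference k f.1 f.2 (({k} : Finset (Fin K)).piecewise w x.1) x.2.1
        = interference k f.1 f.2 x.1 x.2.1 := by
      rw [interference, interference]
      congr 1
      refine Finset.sum_congr rfl fun j hj => ?_
      rw [Finset.piecewise_eq_of_notMem _ _ _ (by simpa using Finset.ne_of_mem_erase hj)]
    rw [hB, Finset.piecewise_eq_of_mem _ _ _ (Finset.mem_singleton_self k)]
  rw [this]
  exact entropy_map_le Scheme.one_lt_card _ _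

/-- Given all the messages and the key, the answers reveal the mask. -/
theorem le_partialEntropy_answers (hμ : ∀ σ ∈ μ.support, ∀ τ : Fin t, m ≤ τ → σ τ = 0) (k : Fin K) (f : Bool × (Fin K → ZMod N)) :
    (if f.1 then entropy (Fintype.card X) μ else 0)
      ≤ partialEntropy (Fintype.card X) (prodLaw μ ν) Finset.univ
        (maskedAnswers m k f) := by
  obtain ⟨c, v⟩ := f
  cases c
  · simp
  simp only [if_true]
  rw [partialEntropy_univ, ← tsum_const_mul (PMF.uniformOfFintype (Messages K ((N - 1) * t) X))
    (entropy _ μ)]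
  refine tsum_mul_le_tsum_mul _ fun w _ => ?_
  -- the database `0` sends the mask plus a sum of known rows
  let R : (Fin N → List (ZMod (Fintype.card X))) → Fin t → ZMod (Fintype.card X) := fun A τ =>
    (A (database 0)).getD τ 0 - (∑ j, row (w j) (v j)) τ
  have : μ = ((prodLaw μ ν).map (maskedAnswers m k (true, v) w)).map R := by
    rw [PMF.map_comp]
    conv_lhs => rw [← prodLaw_map_fst μ ν]
    refine map_congr_support _ fun x hx => ?_
    have hσ := hμ x.1 ((PMF.mem_support_iff _ _).2 fun h =>
      (PMF.mem_support_iff _ _).1 hx (by rw [prodLaw_apply, h, zero_mul]))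
    funext τ
    simp only [maskedAnswers, R, Function.comp_apply, getD_truncatedSum _ _ hσ,
      database_cast, Pi.single_zero, add_zero]
    simp [maskedSum]
  conv_lhs => rw [this]
  exact entropy_map_le Scheme.one_lt_card _ _

end Analysis

theorem totalLeakage_maskedScheme_le [NeZero N] (hm : m ≤ t) {p : ℝ} (h0 : 0 ≤ p) (h1 : p ≤ 1)
    {μ : PMF (Fin t → ZMod (Fintype.card X))}
    (hμ : ∀ σ ∈ μ.support, ∀ τ : Fin t, m ≤ τ → σ τ = 0) {E : Type} {ν : PMF E} {h h' : ℝ}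
    (hh : entropy (Fintype.card X) μ = ENNReal.ofReal h) (hh0 : 0 ≤ h) (hht : h ≤ t)
    (hh' : entropy (Fintype.card X) ν = ENNReal.ofReal h') (k : Fin K) :
    (maskedScheme hm (coin p h0 h1) μ hμ ν : Scheme N K _ X).totalLeakage k
      ≤ ENNReal.ofReal ((1 - 1 / (N : ℝ) ^ (K - 1)) * (t - p * h)) := by
  classical
  set C : Scheme N K ((N - 1) * t) X := maskedScheme hm (coin p h0 h1) μ hμ ν
  have hN1 : (1 : ℝ) ≤ N := by exact_mod_cast NeZero.one_le
  have ha0 : 0 < (N : ℝ) ^ (K - 1) := by positivity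
  have ha1 : 0 ≤ 1 - 1 / (N : ℝ) ^ (K - 1) := by
    rw [sub_nonneg, div_le_one ha0]; exact one_le_pow₀ hN1
  have hph : p * h ≤ t := (mul_le_of_le_one_left hh0 h1).trans hht
  have hfin : C.answersEntropy k Finset.univ ≠ ∞ := by
    refine ne_top_of_le_ne_top ?_ (C.answersEntropy_univ_le k)
    have : C.commonEntropy = ENNReal.ofReal h + ENNReal.ofReal h' := by
      rw [← hh, ← hh']; exact entropy_prodLaw Scheme.one_lt_card μ ν
    rw [this]
    finiteness
  have hy : ENNReal.ofReal (p * h) ≤ C.answersEntropy k Finset.univ := by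
    calc ENNReal.ofReal (p * h)
        = ∑' c, coin p h0 h1 c * ENNReal.ofReal (if c then h else 0) := by
          rw [tsum_coin h0 h1 hh0 le_rfl, mul_zero, add_zero]
      _ = ∑' f, prodLaw (coin p h0 h1) (PMF.uniformOfFintype (Fin K → ZMod N)) f
          * (if f.1 then entropy (Fintype.card X) μ else 0) := by
          rw [tsum_prodLaw_mul]
          refine tsum_congr fun c => ?_
          cases c
          · simp
          · simp only [if_true]
            rw [tsum_const_mul, hh]
      _ ≤ _ := tsum_mul_le_tsum_mul _ fun f _ => le_partialEntropy_answers μ ν hμ k f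
  have hx : C.answersEntropy k {k}
      ≤ ENNReal.ofReal ((1 - 1 / (N : ℝ) ^ (K - 1)) * t + p * h / (N : ℝ) ^ (K - 1)) := by
    -- the interference vanishes when the `K - 1` residues requested of the other messages do
    have hv : ∀ c : Bool, ∑' v, PMF.uniformOfFintype (Fin K → ZMod N) v
        * entropy (Fintype.card X) ((prodLaw (PMF.uniformOfFintype (Messages K ((N - 1) * t) X))
          (prodLaw μ ν)).map fun x => interference k c v x.1 x.2.1)
        ≤ ENNReal.ofReal (if c then h / (N : ℝ) ^ (K - 1) + (1 - 1 / (N : ℝ) ^ (K - 1)) * t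
          else (1 - 1 / (N : ℝ) ^ (K - 1)) * t) := by
      intro c
      have hA : 0 ≤ if c then h else 0 := by split_ifs <;> simp [hh0]
      have hcard : (Fintype.card ({j : Fin K // j ≠ k} → ZMod N) : ℝ) = (N : ℝ) ^ (K - 1) := by
        rw [Fintype.card_fun, ZMod.card]
        simp
      calc _ ≤ ∑' v, PMF.uniformOfFintype (Fin K → ZMod N) v * ENNReal.ofReal
            (if (fun j : {j : Fin K // j ≠ k} => v j) = 0 then (if c then h else 0) else t) := by
            refine tsum_mul_le_tsum_mul _ fun v _ => ?_
            split_ifs with hz hc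
            · rw [entropy_interference_of_eq_zero μ ν k c v fun j hj => congrFun hz ⟨j, hj⟩,
                if_pos hc, hh]
            · rw [entropy_interference_of_eq_zero μ ν k c v fun j hj => congrFun hz ⟨j, hj⟩,
                if_neg hc]
              simp
            · exact (entropy_interference_le μ ν k c v).trans_eq (ENNReal.ofReal_natCast t).symm
        _ = _ := by
            rw [← tsum_map_mul (PMF.uniformOfFintype (Fin K → ZMod N))
              (fun v (j : {j : Fin K // j ≠ k}) => v j)
              fun u => ENNReal.ofReal (if u = 0 then (if c then h else 0) else t),
              uniform_map_restrict, tsum_uniform_ite 0 hA (Nat.cast_nonneg t), hcard]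
            cases c <;> simp
    calc C.answersEntropy k {k}
        ≤ ∑' f, prodLaw (coin p h0 h1) (PMF.uniformOfFintype (Fin K → ZMod N)) f
          * entropy (Fintype.card X) ((prodLaw (PMF.uniformOfFintype (Messages K ((N - 1) * t) X))
          (prodLaw μ ν)).map fun x => interference k f.1 f.2 x.1 x.2.1) :=
          tsum_mul_le_tsum_mul _ fun f _ => partialEntropy_answers_le μ ν k f
      _ ≤ ∑' c, coin p h0 h1 c * ENNReal.ofReal (if c then
            h / (N : ℝ) ^ (K - 1) + (1 - 1 / (N : ℝ) ^ (K - 1)) * t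
          else (1 - 1 / (N : ℝ) ^ (K - 1)) * t) := by
          rw [tsum_prodLaw_mul]
          exact tsum_mul_le_tsum_mul _ fun c _ => hv c
      _ = _ := by
          rw [tsum_coin h0 h1 (by positivity) (by positivity)]
          congr 1
          ring
  rw [C.totalLeakage_le_iff k hfin]
  refine hx.trans (le_trans (le_of_eq ?_) (add_le_add_right hy _))
  rw [← ENNReal.ofReal_add (mul_nonneg ha1 (by linarith)) (by positivity)]
  congr 1
  ring

theorem downloadCost_maskedScheme [NeZero N] (hm : m ≤ t) {p : ℝ} (h0 : 0 ≤ p) (h1 : p ≤ 1)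
    {μ : PMF (Fin t → ZMod (Fintype.card X))}
    (hμ : ∀ σ ∈ μ.support, ∀ τ : Fin t, m ≤ τ → σ τ = 0) {E : Type} {ν : PMF E} (k : Fin K) :
    (maskedScheme hm (coin p h0 h1) μ hμ ν : Scheme N K _ X).downloadCost k
      = ENNReal.ofReal (N * t - (t - p * m) / (N : ℝ) ^ (K - 1)) := by
  have hN1 : (1 : ℝ) ≤ N := by exact_mod_cast NeZero.one_le
  have hNK : (0 : ℝ) < (N : ℝ) ^ K := by positivity
  have ha1 : 0 ≤ 1 - 1 / (N : ℝ) ^ K := by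
    rw [sub_nonneg, div_le_one hNK]; exact one_le_pow₀ hN1
  have hcard : (Fintype.card (Fin K → ZMod N) : ℝ) = (N : ℝ) ^ K := by
    rw [Fintype.card_fun, ZMod.card]
    simp
  have hlen : ∀ u, ∑' f, prodLaw (coin p h0 h1) (PMF.uniformOfFintype (Fin K → ZMod N)) f
      * (answerLength t m (f.1, f.2 + u) : ℝ≥0∞)
      = ENNReal.ofReal (t - (t - p * m) / (N : ℝ) ^ K) := by
    intro u
    rw [← tsum_map_mul _ (fun f : Bool × (Fin K → ZMod N) => (f.1, f.2 + u)) fun x => (answerLength t m x : ℝ≥0∞),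
      map_query, tsum_prodLaw_mul]
    have : ∀ c : Bool, ∑' v, PMF.uniformOfFintype (Fin K → ZMod N) v
        * (answerLength t m (c, v) : ℝ≥0∞) = ENNReal.ofReal (if c then
          m / (N : ℝ) ^ K + (1 - 1 / (N : ℝ) ^ K) * t else (1 - 1 / (N : ℝ) ^ K) * t) := by
      intro c
      have hA : (0 : ℝ) ≤ if c then (m : ℝ) else 0 := by split_ifs <;> simp
      calc _ = ∑' v, PMF.uniformOfFintype (Fin K → ZMod N) v * ENNReal.ofReal
            (if v = 0 then (if c then (m : ℝ) else 0) else t) := by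
            refine tsum_congr fun v => ?_
            congr 1
            rw [answerLength]
            split_ifs <;> simp
        _ = _ := by
            rw [tsum_uniform_ite 0 hA (Nat.cast_nonneg t), hcard]
            cases c <;> simp
    simp_rw [this]
    rw [tsum_coin h0 h1 (by positivity) (by positivity)]
    congr 1
    ring
  have : (maskedScheme hm (coin p h0 h1) μ hμ ν : Scheme N K _ X).downloadCost k
      = ENNReal.ofReal (Real.logb (Fintype.card X) (Fintype.card (ZMod (Fintype.card X)))) *
        ∑ n : Fin N, ∑' f, prodLaw (coin p h0 h1) (PMF.uniformOfFintype (Fin K → ZMod N)) f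
          * (answerLength t m (f.1, f.2 + Pi.single k ((n : ℕ) : ZMod N)) : ℝ≥0∞) := by
    rw [Scheme.downloadCost]
    congr 4
  rw [this, Finset.sum_congr rfl fun n _ => hlen _, ZMod.card,
    Real.logb_self_eq_one Scheme.one_lt_card, ENNReal.ofReal_one, one_mul, Finset.sum_const,
    Finset.card_univ, Fintype.card_fin, nsmul_eq_mul, ← ENNReal.ofReal_natCast N,
    ← ENNReal.ofReal_mul (Nat.cast_nonneg N)]
  congr 1
  obtain ⟨j, rfl⟩ : ∃ j, K = j + 1 := ⟨K - 1, by have := k.isLt; omega⟩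
  rw [Nat.add_sub_cancel, pow_succ]
  field_simp

/-- A mask of prescribed entropy `h ≤ m` that is supported on the first `m` of `t` coordinates. -/
theorem exists_mask (hm : m ≤ t) {h : ℝ} (h0 : 0 ≤ h) (h1 : h ≤ m) :
    ∃ μ : PMF (Fin t → ZMod (Fintype.card X)),
      entropy (Fintype.card X) μ = ENNReal.ofReal h ∧
      ∀ σ ∈ μ.support, ∀ τ : Fin t, m ≤ τ → σ τ = 0 := by
  obtain ⟨μ, hμ⟩ := exists_entropy_eq (α := Fin m → ZMod (Fintype.card X))
    (b := Fintype.card X) Scheme.one_lt_card h0 (by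
      rw [Fintype.card_fun, ZMod.card, Nat.cast_pow, Real.logb_pow,
        Real.logb_self_eq_one Scheme.one_lt_card]
      simpa using h1)
  let pad : (Fin m → ZMod (Fintype.card X)) → Fin t → ZMod (Fintype.card X) := fun σ τ =>
    if h : (τ : ℕ) < m then σ ⟨τ, h⟩ else 0
  refine ⟨μ.map pad, ?_, ?_⟩
  · rw [entropy_map_of_injOn, hμ]
    intro σ _ σ' _ hσ
    funext i
    simpa [pad] using congrFun hσ (Fin.castLE hm i)
  · intro σ hσ τ hτ
    rw [PMF.support_map] at hσ
    obtain ⟨σ', -, rfl⟩ := hσ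
    simp [pad, hτ]

/-- The costs achieved by the masked scheme: the mask occupies `m` of the `t` columns, has entropy
`h ≤ m`, and is used with probability `p`. -/
theorem mem_costs (hN : 1 ≤ N) (hm : m ≤ t) {p h s ρ : ℝ} (hp0 : 0 ≤ p) (hp1 : p ≤ 1)
    (hh0 : 0 ≤ h) (hhm : h ≤ m) (hρ : h ≤ ρ * ((N - 1) * t : ℕ))
    (hs : (1 - 1 / (N : ℝ) ^ (K - 1)) * (t - p * h) ≤ s * ((N - 1) * t : ℕ)) :
    ENNReal.ofReal (N * t - (t - p * m) / (N : ℝ) ^ (K - 1))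
      ∈ costs N K ((N - 1) * t) X s ρ := by
  have : NeZero N := ⟨by omega⟩
  obtain ⟨μ, hμ, hsupp⟩ := exists_mask (X := X) hm hh0 hhm
  have hg : 0 ≤ ρ * ((N - 1) * t : ℕ) - h := sub_nonneg.2 hρ
  -- the additional randomness makes up for the missing entropy `ρ L - h`
  obtain ⟨ν, hν, -⟩ := exists_mask (X := X) le_rfl hg (Nat.le_ceil _)
  refine ⟨maskedScheme hm (coin p hp0 hp1) μ hsupp ν, fun k => ?_, ?_, fun k =>
    downloadCost_maskedScheme hm hp0 hp1 hsupp k⟩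
  · exact (totalLeakage_maskedScheme_le hm hp0 hp1 hsupp hμ hh0
      (hhm.trans (by exact_mod_cast hm)) hν k).trans (ENNReal.ofReal_le_ofReal hs)
  · refine (entropy_prodLaw Scheme.one_lt_card μ ν).trans ?_
    rw [hμ, hν, ← ENNReal.ofReal_add hh0 hg]
    congr 1; ring

end Construction

/-! ### Attaining the lower bound -/

section Optimality

variable {N K : ℕ} {X : Type*} [Fintype X] [Nontrivial X]

theorem cast_length (hN : 2 ≤ N) (t : ℕ) : (((N - 1) * t : ℕ) : ℝ) = ((N : ℝ) - 1) * t := by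
  rw [Nat.cast_mul, Nat.cast_sub (by omega), Nat.cast_one]

/-- Among `t` columns, `max (rhoMin * L) 0` is the mean number that has to be masked. It is at most
`t`, it meets the leakage constraint, and it yields the optimal cost. -/
theorem masked_columns (hN : 2 ≤ N) (hK : 2 ≤ K) {s : ℝ} (hs : 0 ≤ s) (t : ℕ) :
    max (rhoMin N K s * ((N - 1) * t : ℕ)) 0 ≤ t ∧
    (1 - 1 / (N : ℝ) ^ (K - 1)) * (t - max (rhoMin N K s * ((N - 1) * t : ℕ)) 0)
      ≤ s * ((N - 1) * t : ℕ) ∧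
    N * t - (t - max (rhoMin N K s * ((N - 1) * t : ℕ)) 0) / (N : ℝ) ^ (K - 1)
      = ((N - 1) * t : ℕ) * optRate N K s := by
  have ha := one_lt_pow_pred hN hK
  have hN1 : (0 : ℝ) < (N : ℝ) - 1 := by
    have : (2 : ℝ) ≤ N := by exact_mod_cast hN
    linarith
  rw [cast_length hN]
  have ht : (0 : ℝ) ≤ t := Nat.cast_nonneg t
  set a := (N : ℝ) ^ (K - 1) with ha_def
  have ha1 : 0 < a - 1 := by linarith
  have ha0 : 0 < a := by linarith
  have hr : rhoMin N K s = a / (a - 1) * (threshold N K - s) := by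
    rw [rhoMin, threshold, ← ha_def]; field_simp
  rcases le_or_gt s (threshold N K) with h | h
  · have hr0 : 0 ≤ rhoMin N K s := by
      rw [hr]; exact mul_nonneg (by positivity) (sub_nonneg.2 h)
    rw [max_eq_left (by positivity), optRate_of_le h, rhoMin, ← ha_def]
    refine ⟨?_, le_of_eq ?_, ?_⟩
    · have e : (1 / ((N : ℝ) - 1) - a / (a - 1) * s) * (((N : ℝ) - 1) * t)
          = t - a / (a - 1) * s * (((N : ℝ) - 1) * t) := by field_simp
      rw [e, sub_le_self_iff]
      positivity
    · field_simp; ring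
    · field_simp; ring
  · have hr0 : rhoMin N K s ≤ 0 := by
      rw [hr]; exact mul_nonpos_of_nonneg_of_nonpos (by positivity) (by linarith)
    rw [max_eq_right (mul_nonpos_of_nonpos_of_nonneg hr0 (by positivity)),
      optRate_of_lt hN hK h]
    rw [threshold, ← ha_def] at *
    refine ⟨ht, ?_, ?_⟩
    · have e : (1 - 1 / a) * ((t : ℝ) - 0)
          = (1 / ((N : ℝ) - 1) * (1 - 1 / a)) * (((N : ℝ) - 1) * t) := by field_simp; ring
      rw [e]
      gcongr
    · field_simp; ring

/-- With a whole number `m` of mask letters available, masking all of them with the right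
probability meets the lower bound exactly. -/
theorem optimal_mem_costs (hN : 2 ≤ N) (hK : 2 ≤ K) {s ρ : ℝ} (hs : 0 ≤ s) (t m : ℕ)
    (hm : rhoMin N K s * ((N - 1) * t : ℕ) ≤ m) (hmρ : (m : ℝ) ≤ ρ * ((N - 1) * t : ℕ)) :
    ENNReal.ofReal (((N - 1) * t : ℕ) * optRate N K s) ∈ costs N K ((N - 1) * t) X s ρ := by
  obtain ⟨h1, h2, h3⟩ := masked_columns hN hK hs t
  have hr0 := le_max_right (rhoMin N K s * ((N - 1) * t : ℕ)) 0
  have hrm : max (rhoMin N K s * ((N - 1) * t : ℕ)) 0 ≤ (min m t : ℕ) := by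
    rw [Nat.cast_min]
    exact le_min (max_le hm (Nat.cast_nonneg m)) h1
  set r := max (rhoMin N K s * ((N - 1) * t : ℕ)) 0
  -- if `min m t = 0` then `r = 0`, and the junk value `r / 0 = 0` is the right probability
  have hp : r / (min m t : ℕ) * (min m t : ℕ) = r := by
    rcases Nat.eq_zero_or_pos (min m t) with h0 | h0
    · rw [h0, Nat.cast_zero] at hrm
      rw [h0, Nat.cast_zero, mul_zero, le_antisymm hrm hr0]
    · exact div_mul_cancel₀ _ (by exact_mod_cast h0.ne')
  have := mem_costs (X := X) (N := N) (K := K) (t := t) (m := min m t) (p := r / (min m t : ℕ))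
    (h := (min m t : ℕ)) (s := s) (ρ := ρ) (by omega) (min_le_right _ _) (by positivity)
    (div_le_one_of_le₀ hrm (Nat.cast_nonneg _)) (Nat.cast_nonneg _) le_rfl
    (le_trans (by exact_mod_cast min_le_left m t) hmρ) (by rwa [hp])
  rwa [hp, h3] at this

/-- A mask of entropy exactly `max (rhoMin * L) 0`, always used, costs at most one letter more
than the lower bound. -/
theorem minCost_le (hN : 2 ≤ N) (hK : 2 ≤ K) {s ρ : ℝ} (hs : 0 ≤ s) (hρ : 0 ≤ ρ)
    (h : rhoMin N K s ≤ ρ) (t : ℕ) :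
    minCost N K ((N - 1) * t) X s ρ
      ≤ ENNReal.ofReal (((N - 1) * t : ℕ) * optRate N K s + 1) := by
  obtain ⟨h1, h2, h3⟩ := masked_columns hN hK hs t
  have hr0 := le_max_right (rhoMin N K s * ((N - 1) * t : ℕ)) 0
  have hrρ : max (rhoMin N K s * ((N - 1) * t : ℕ)) 0 ≤ ρ * ((N - 1) * t : ℕ) :=
    max_le (by gcongr) (by positivity)
  set r := max (rhoMin N K s * ((N - 1) * t : ℕ)) 0
  have ha := one_lt_pow_pred hN hK
  refine (sInf_le (mem_costs (m := ⌈r⌉₊) (p := 1) (h := r) (by omega) (Nat.ceil_le.2 h1)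
    zero_le_one le_rfl hr0 (Nat.le_ceil r) hrρ (by rwa [one_mul]))).trans
    (ENNReal.ofReal_le_ofReal ?_)
  rw [← h3, one_mul]
  have hc := (Nat.ceil_lt_add_one hr0).le
  have h4 : ((⌈r⌉₊ : ℝ) - r) / (N : ℝ) ^ (K - 1) ≤ 1 := by
    rw [div_le_one (by linarith)]
    linarith
  have e : ((⌈r⌉₊ : ℝ) - r) / (N : ℝ) ^ (K - 1)
      = ((t : ℝ) - r) / (N : ℝ) ^ (K - 1) - (t - ⌈r⌉₊) / (N : ℝ) ^ (K - 1) := by ring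
  linarith

theorem minRate_eq (hN : 2 ≤ N) (hK : 2 ≤ K) {s ρ : ℝ} (hs : 0 ≤ s) (hρ : 0 ≤ ρ)
    (h : rhoMin N K s ≤ ρ) : minRate N K X s ρ = ENNReal.ofReal (optRate N K s) := by
  refine le_antisymm ?_ (le_iInf₂ fun L hL => ?_)
  · have hlim : Filter.Tendsto (fun t : ℕ => ENNReal.ofReal (optRate N K s + 1 / ((t : ℝ) + 1)))
        Filter.atTop (nhds (ENNReal.ofReal (optRate N K s))) := by
      refine (ENNReal.continuous_ofReal.tendsto _).comp ?_
      simpa using tendsto_one_div_add_atTop_nhds_zero_nat.const_add (optRate N K s)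
    refine ge_of_tendsto' hlim fun t => ?_
    have hL1 : t + 1 ≤ (N - 1) * (t + 1) := Nat.le_mul_of_pos_left _ (by omega)
    have hL0 : (0 : ℝ) < ((N - 1) * (t + 1) : ℕ) := by
      exact_mod_cast (Nat.succ_pos t).trans_le hL1
    refine (iInf₂_le ((N - 1) * (t + 1)) (by omega)).trans ?_
    refine (ENNReal.div_le_div_right (minCost_le hN hK hs hρ h (t + 1)) _).trans ?_
    rw [← ENNReal.ofReal_natCast, ← ENNReal.ofReal_div_of_pos hL0]
    refine ENNReal.ofReal_le_ofReal ?_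
    rw [add_div, mul_div_cancel_left₀ _ hL0.ne']
    gcongr
    exact_mod_cast hL1
  · rw [ENNReal.le_div_iff_mul_le (by left; exact_mod_cast (by omega : L ≠ 0))
      (by left; exact ENNReal.natCast_ne_top L)]
    refine le_trans (le_of_eq ?_) (le_minCost hN hK hL hs hρ)
    rw [mul_comm, ENNReal.ofReal_mul (Nat.cast_nonneg L), ENNReal.ofReal_natCast]

end Optimality

end

end PIR

theorem theorem1 (N K : ℕ) (hN : 2 ≤ N) (hK : 2 ≤ K) (X : Type*) [Fintype X] [Nontrivial X]
    (s ρ : ℝ) (hs : 0 ≤ s) (hρ : 0 ≤ ρ) :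
    (PIR.rhoMin N K s ≤ ρ →
      -- the lower bound, for every message length
      (∀ L : ℕ, 1 ≤ L →
        ENNReal.ofReal (L * PIR.optRate N K s) ≤ PIR.minCost N K L X s ρ) ∧
      -- it is the infimum over all message lengths
      PIR.minRate N K X s ρ = ENNReal.ofReal (PIR.optRate N K s) ∧
      -- it is a minimum, attained by a scheme, at the following message lengths
      (∀ L : ℕ, 1 ≤ L → (N - 1) ∣ L →
        (∃ m : ℕ, PIR.rhoMin N K s * L ≤ m ∧ (m : ℝ) ≤ ρ * L) →
        IsLeast (PIR.costs N K L X s ρ) (ENNReal.ofReal (L * PIR.optRate N K s)))) ∧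
    (ρ < PIR.rhoMin N K s →
      ∀ L : ℕ, 1 ≤ L →
        PIR.costs N K L X s ρ = ∅ ∧ PIR.minCost N K L X s ρ = ⊤) := by
  refine ⟨fun h => ⟨fun L hL => PIR.le_minCost hN hK hL hs hρ, PIR.minRate_eq hN hK hs hρ h, ?_⟩,
    fun h L hL => ?_⟩
  · rintro L hL ⟨t, rfl⟩ ⟨m, hm, hmρ⟩
    refine ⟨PIR.optimal_mem_costs hN hK hs t m hm hmρ, fun D hD => ?_⟩
    exact (PIR.le_minCost hN hK hL hs hρ).trans (sInf_le hD)
  · have hempty := PIR.costs_eq_empty (X := X) hN hK hL hs hρ h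
    exact ⟨hempty, by rw [PIR.minCost, hempty, sInf_empty]⟩
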